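/- **Definitions.** For $n,A\ge 0$ let $S(n,A)$ be the set of *building sequences* of width $n$ and area $A$: the finite sequences of non-negative integers $a=(f_0,p_1,f_1,p_2,f_2,\dots,p_h,f_h)$, $h\ge 0$, with $p_1,\dots,p_h>0$, $$\sum_{i=0}^h f_i+2\sum_{i=1}^h p_i=n,\qquad \sum_{i=0}^h i f_i+\sum_{i=1}^h (2i-1)p_i=A .$$ Put $P(a)=m(a)\cdot \mathrm{perm}(a)$, where (with $p_{h+1}=0$) $$m(a)=\prod_{i=1}^{h}\binom{p_{i+1}+f_i+p_i-1}{p_i-1}\binom{p_i+f_{i-1}}{f_{i-1}},\qquad \mathrm{perm}(a)=\prod_{i=0}^h(2i+1)^{f_i}\prod_{i=1}^h i^{2p_i}.$$ A Motzkin path of width $n$ is a sequence of $n$ moves $U,H,D$ (changing the height by $+1,0,-1$) from height $0$ to height $0$ that never goes below height $0$; its area is the area between it and the horizontal axis; the height of a move is the maximum height of the path during this move. The path can be built from $a$ if for every $i$ it has exactly $f_i$ moves $H$, $p_i$ moves $U$ and $p_i$ moves $D$ of height $i$ (where $p_0=0$ and $f_i=p_i=0$ for $i>h$). A permutation $\pi$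 of $\{1,\dots,n\}$ has total displacement $\sum_i|i-\pi(i)|$, and maps to the path whose $i$-th move is $U$ if $\pi(i)>i<\pi^{-1}(i)$, $D$ if $\pi(i)<i>\pi^{-1}(i)$, and $H$ otherwise. An algorithm is a program for a random access machine over the natural numbers with addition, (truncated) subtraction, indirect addressing, conditionals, loops and uniformly random integers from $\{0,\dots,k\}$, in which every command takes one step; *polynomial time* means that the number of steps is bounded, for all random choices, by a polynomial in $n$. **Theorem.** There are randomized polynomial-time algorithms $R_1$ and $R_2$ such that 1. for all $n,A$, given $a\in S(n,A)$, $R_1$ outputs a uniformly random one among the Motzkin paths of width $n$ and area $A$ that can be built from $a$; 2. for all $n,A$, given a Motzkin path of width $n$ and area $A$, $R_2$ outputs a uniformly random one among the permutations of $\{1,\dots,n\}$ that map to this path; 3. for every set $I$ of pairs $(n,A)$ (for example all pairs of positive integers), and every polynomial-time algorithm $Q$ which, given any $(n,A)\in I$ with $S(n,A)\neq\emptyset$, samples an element $a$ of $S(n,A)$ with probability proportional to $P(a)$: running $Q$, then $R_1$ on its output, and then $R_2$ on the output of $R_1$, is a polynomial-time algorithm which, given any $(n,A)\in I$ for which there are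 permutations of $\{1,\dots,n\}$ of total displacement $2A$, samples one of these permutations uniformly at random. -/

import Mathlib

open scoped ENNReal

namespace DispSampling

/-! ### Randomized algorithms with a step count

Programs for a random access machine over natural numbers: scalar variables `x₀, x₁, …`, arrays
`a₀, a₁, …` with indirect addressing, addition, truncated subtraction, conditionals, loops, and
random integers. There is no multiplication, so in `T` steps a fixed program only produces numbers
of bit length `O(T)` plus that of the input: up to a polynomial, the number of steps is the running
time in the bit model. -/

/-- Expressions (of a fixed size in any given program). -/
inductive Expr : Type
  | const (k : ℕ)
  | var (x : ℕ)
  | get (a : ℕ) (i : Expr)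
  | add (e₁ e₂ : Expr)
  | sub (e₁ e₂ : Expr)

/-- Programs. -/
inductive Prog : Type
  /-- `x := e` -/
  | set (x : ℕ) (e : Expr)
  /-- `a[i] := e` -/
  | put (a : ℕ) (i e : Expr)
  /-- `x :=` a fresh integer, uniformly distributed in `{0, …, e}` -/
  | rand (x : ℕ) (e : Expr)
  | seq (c d : Prog)
  /-- run `c` if `e ≠ 0`, and `d` if `e = 0` -/
  | cond (e : Expr) (c d : Prog)
  /-- repeat `c` as long as `e ≠ 0` -/
  | loop (e : Expr) (c : Prog)

/-- The contents of the memory. -/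
structure Store : Type where
  var : ℕ → ℕ
  arr : ℕ → ℕ → ℕ

/-- The value of an expression. -/
def Expr.val (s : Store) : Expr → ℕ
  | const k => k
  | var x => s.var x
  | get a i => s.arr a (i.val s)
  | add e₁ e₂ => e₁.val s + e₂.val s
  | sub e₁ e₂ => e₁.val s - e₂.val s

/-- The memory after `x := v`. -/
def Store.setVar (s : Store) (x v : ℕ) : Store :=
  { s with var := Function.update s.var x v }

/-- The memory after `a[i] := v`. -/
def Store.setArr (s : Store) (a i v : ℕ) : Store :=
  { s with arr := Function.update s.arr a (Function.update (s.arr a) i v) }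

/-- A configuration: the commands that are still to be run, in this order, and the memory.
The machine has halted when no command is left. -/
abbrev Config : Type := List Prog × Store

/-- One step of the machine (a halted machine stays as it is). -/
noncomputable def step : Config → PMF Config
  | ([], s) => PMF.pure ([], s)
  | (.set x e :: k, s) => PMF.pure (k, s.setVar x (e.val s))
  | (.put a i e :: k, s) => PMF.pure (k, s.setArr a (i.val s) (e.val s))
  | (.rand x e :: k, s) =>
      (PMF.uniformOfFintype (Fin (e.val s + 1))).map fun r => (k, s.setVar x r.val)
  | (.seq c d :: k, s) => PMF.pure (c :: d :: k, s)
  | (.cond e c d :: k, s) => PMF.pure (if e.val s ≠ 0 then (c :: k, s) else (d :: k, s))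
  | (.loop e c :: k, s) => PMF.pure (if e.val s ≠ 0 then (c :: .loop e c :: k, s) else (k, s))

/-- The law of the configuration after `t` steps. -/
noncomputable def runFor : ℕ → Config → PMF Config
  | 0, c => PMF.pure c
  | t + 1, c => (step c).bind (runFor t)

/-- The initial memory on input `l`: its length in `x₀`, its entries in `a₀`, and `0` elsewhere. -/
def Store.input (l : List ℕ) : Store where
  var x := if x = 0 then l.length else 0
  arr a i := if a = 0 then l.getD i 0 else 0

/-- The list which the memory holds as output: its length is in `x₀`, its entries are in `a₀`. -/
def Store.output (s : Store) : List ℕ := (List.range (s.var 0)).map (s.arr 0)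

/-- On input `l`, the program `c` halts after at most `T` steps, whatever the random choices. -/
def HaltsWithin (c : Prog) (l : List ℕ) (T : ℕ) : Prop :=
  ∀ z ∈ (runFor T ([c], Store.input l)).support, z.1 = []

/-- The law of the output of the program `c` on input `l`, read after `T` steps. -/
noncomputable def outputLaw (c : Prog) (l : List ℕ) (T : ℕ) : PMF (List ℕ) :=
  (runFor T ([c], Store.input l)).map fun z => z.2.output

/-- The law `μ` lives on `X` and is proportional to `w` there. -/
def IsProportionalOn (μ : PMF (List ℕ)) (X : Set (List ℕ)) (w : List ℕ → ℕ) : Prop :=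
  ∃ c : ℝ≥0∞, (∀ l ∈ X, μ l = c * (w l : ℝ≥0∞)) ∧ ∀ l ∉ X, μ l = 0

/-- The law `μ` is the uniform distribution on the finite set `X`. -/
def IsUniformOn (μ : PMF (List ℕ)) (X : Set (List ℕ)) : Prop :=
  X.Finite ∧ (∀ l ∈ X, μ l = (X.ncard : ℝ≥0∞)⁻¹) ∧ ∀ l ∉ X, μ l = 0

/-! ### Building sequences -/

/-- The entry `fᵢ` of `a = (f₀, p₁, f₁, …, pₕ, fₕ)` (`0` if `i > h`). -/
def flats (a : List ℕ) (i : ℕ) : ℕ := a.getD (2 * i) 0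

/-- The entry `pᵢ` of `a = (f₀, p₁, f₁, …, pₕ, fₕ)` (`0` if `i = 0` or `i > h`). -/
def peaks (a : List ℕ) (i : ℕ) : ℕ := if i = 0 then 0 else a.getD (2 * i - 1) 0

/-- The number `h` for `a = (f₀, p₁, f₁, …, pₕ, fₕ)`. -/
def top (a : List ℕ) : ℕ := a.length / 2

/-- The set `S(n, A)` of building sequences of width `n` and area `A`. -/
def S (n A : ℕ) : Set (List ℕ) :=
  {a | a.length = 2 * top a + 1 ∧
    (∀ i ∈ Finset.Icc 1 (top a), 0 < peaks a i) ∧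
    ∑ i ∈ Finset.range (top a + 1), flats a i + 2 * ∑ i ∈ Finset.Icc 1 (top a), peaks a i = n ∧
    ∑ i ∈ Finset.range (top a + 1), i * flats a i +
      ∑ i ∈ Finset.Icc 1 (top a), (2 * i - 1) * peaks a i = A}

/-- `m(a) = ∏ᵢ C(fᵢ + pᵢ + pᵢ₊₁ - 1, pᵢ - 1) C(pᵢ + fᵢ₋₁, fᵢ₋₁)`, over `1 ≤ i ≤ h`,
with `pₕ₊₁ = 0`. -/
def mult (a : List ℕ) : ℕ :=
  ∏ i ∈ Finset.Icc 1 (top a),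
    (peaks a (i + 1) + flats a i + peaks a i - 1).choose (peaks a i - 1) *
      (peaks a i + flats a (i - 1)).choose (flats a (i - 1))

/-- `perm(a) = ∏ᵢ (2i + 1) ^ fᵢ · ∏ᵢ i ^ (2 pᵢ)`. -/
def perm (a : List ℕ) : ℕ :=
  (∏ i ∈ Finset.range (top a + 1), (2 * i + 1) ^ flats a i) *
    ∏ i ∈ Finset.Icc 1 (top a), i ^ (2 * peaks a i)

/-- `P(a) = m(a) · perm(a)`. -/
def P (a : List ℕ) : ℕ := mult a * perm a

/-! ### Motzkin paths -/

/-- The moves up-right, horizontal-right, down-right. -/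
inductive Move : Type
  | U
  | H
  | D
  deriving DecidableEq

/-- The change of height along a move. -/
def Move.rise : Move → ℤ
  | U => 1
  | H => 0
  | D => -1

/-- The code of a move in the memory of the machine. -/
def Move.code : Move → ℕ
  | U => 2
  | H => 1
  | D => 0

/-- The height of the path after its first `k` moves. -/
def height (mz : List Move) (k : ℕ) : ℤ := ((mz.take k).map Move.rise).sum

/-- The maximum height of the path during the move with (zero-based) index `k`. -/
def moveHeight (mz : List Move) (k : ℕ) : ℤ := max (height mz k) (height mz (k + 1))

/-- The set `MZ(n, A)` of Motzkin paths of width `n` and area `A`; twice the area is the sum of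
`height k + height (k + 1)` over all moves. -/
def MZ (n A : ℕ) : Set (List Move) :=
  {mz | mz.length = n ∧ (∀ k ≤ n, 0 ≤ height mz k) ∧ height mz n = 0 ∧
    ∑ k ∈ Finset.range n, (height mz k + height mz (k + 1)) = 2 * (A : ℤ)}

/-- The number of moves of kind `m` at height `i` in the path. -/
def moveCount (mz : List Move) (m : Move) (i : ℕ) : ℕ :=
  ((Finset.range mz.length).filter fun k => mz[k]? = some m ∧ moveHeight mz k = i).card

/-- The path `mz` arises from the blocks of `a` by splitting them into pieces of width one and
rearranging these: for each `i`, it has `fᵢ` flats of height `i`, and the `pᵢ` peaks of height `i`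
provide its `pᵢ` moves `U` and its `pᵢ` moves `D` of height `i`. -/
def BuiltFrom (a : List ℕ) (mz : List Move) : Prop :=
  ∀ i, moveCount mz .H i = flats a i ∧ moveCount mz .U i = peaks a i ∧
    moveCount mz .D i = peaks a i

/-- The code of a path in the memory of the machine. -/
def pathCode (mz : List Move) : List ℕ := mz.map Move.code

/-! ### Permutations -/

/-- The total displacement `D(π) = ∑ |i - π(i)|`. -/
def displacement {n : ℕ} (π : Equiv.Perm (Fin n)) : ℕ :=
  ∑ i : Fin n, (((i : ℕ) : ℤ) - ((π i : ℕ) : ℤ)).natAbs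

/-- The path of a permutation: `U` at `i` if `π(i) > i < π⁻¹(i)`, `D` if `π(i) < i > π⁻¹(i)`,
and `H` otherwise. -/
def pathOf {n : ℕ} (π : Equiv.Perm (Fin n)) : List Move :=
  List.ofFn fun i => if i < π i ∧ i < π⁻¹ i then .U else if π i < i ∧ π⁻¹ i < i then .D else .H

/-- The one-line notation `(π(1), …, π(n))`, with values in `{1, …, n}`. -/
def permCode {n : ℕ} (π : Equiv.Perm (Fin n)) : List ℕ := List.ofFn fun i => (π i : ℕ) + 1

/-! ### The sampling tasks -/

/-- Given `(n, A) ∈ I`, the program `c` samples an element `a` of `S(n, A)` with probability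
proportional to `P(a)`, in time polynomial in `n`. -/
def SamplesSequences (I : Set (ℕ × ℕ)) (c : Prog) : Prop :=
  ∃ p : Polynomial ℕ, ∀ n A : ℕ, (n, A) ∈ I → (S n A).Nonempty →
    HaltsWithin c [n, A] (p.eval n) ∧
      IsProportionalOn (outputLaw c [n, A] (p.eval n)) (S n A) P

/-- Given `(n, A) ∈ I`, the program `c` samples a permutation uniformly at random among the
permutations of `n` elements with total displacement `2A`, in time polynomial in `n`. -/
def SamplesPermutations (I : Set (ℕ × ℕ)) (c : Prog) : Prop :=
  ∃ p : Polynomial ℕ, ∀ n A : ℕ, (n, A) ∈ I →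
    (∃ π : Equiv.Perm (Fin n), displacement π = 2 * A) →
    HaltsWithin c [n, A] (p.eval n) ∧
      IsUniformOn (outputLaw c [n, A] (p.eval n))
        (permCode '' {π : Equiv.Perm (Fin n) | displacement π = 2 * A})

/-- Given a building sequence `a ∈ S(n, A)`, the program `c` samples uniformly at random one of the
Motzkin paths of width `n` and area `A` that can be built from `a`, in time polynomial in `n`. -/
def SamplesPathOfSequence (c : Prog) : Prop :=
  ∃ p : Polynomial ℕ, ∀ n A : ℕ, ∀ a ∈ S n A,
    HaltsWithin c a (p.eval n) ∧
      IsUniformOn (outputLaw c a (p.eval n)) (pathCode '' {mz ∈ MZ n A | BuiltFrom a mz})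

/-- Given a Motzkin path of width `n`, the program `c` samples uniformly at random one of the
permutations of `n` elements that map to this path, in time polynomial in `n`. -/
def SamplesPermutationOfPath (c : Prog) : Prop :=
  ∃ p : Polynomial ℕ, ∀ n A : ℕ, ∀ mz ∈ MZ n A,
    HaltsWithin c (pathCode mz) (p.eval n) ∧
      IsUniformOn (outputLaw c (pathCode mz) (p.eval n))
        (permCode '' {π : Equiv.Perm (Fin n) | pathOf π = mz})

end DispSampling

namespace DispSampling

/-! ### Running programs -/

/-! Permutations reach building sequences through their paths. With positions counted from zero, the
height of the path of `π` after `k` moves is the number of `j < k` with `π j ≥ k`. Hence the heights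
add up to the sum of the positive parts of `π j - j`, which is half the displacement, and `π` has
displacement `2A` exactly if its path lies in `MZ n A` (`height_pathOf`, `pathOf_mem_MZ`). Each such
path is built from exactly one `a ∈ S n A` (`exists_builtFrom`, `eq_of_builtFrom`). A fixed `π` is
therefore output with probability `c * P(a) * 1 / m(a) * 1 / perm(a) = c`, whatever `a` is, and a
law that is constant on a set and vanishes off it is uniform (`isUniformOn_of_const`).

The factor `1 / m(a)` comes from sampling the path move by move. At each height the moves still to
be made from there can come in any order, except that the very last one is a `D`; choosing uniformly
among the others gives every completion the same probability, the inverse of a product of trinomial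
coefficients (`completions`, `samples_pathLoop`, `completions_eq_mult`).

The factor `1 / perm(a)` comes from labelling the moves from left to right. At height `h` there are
`h` positions without an image and `h` values without a preimage. A `U` opens one more of each, an
`H` has `2h + 1` possibilities, and a `D` has `h * h`. The product of these numbers depends only on
the counts of moves (`samples_labelLoop`, `labelings_eq_perm`).

No set is counted separately: `Samples` asserts that each output has probability `1 / W`, and
`Samples.rand` propagates this backwards through a random choice. The correctness lemmas start from
an arbitrary memory with the right output, not only from a fresh one, because the second and third
programs inherit whatever their predecessors left behind. -/

theorem pmf_bind_congr {α β : Type*} (μ : PMF α) {f g : α → PMF β}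
    (h : ∀ a ∈ μ.support, f a = g a) : μ.bind f = μ.bind g := by
  ext b
  simp only [PMF.bind_apply]
  refine tsum_congr fun a => ?_
  by_cases ha : μ a = 0
  · simp [ha]
  · rw [h a ((PMF.mem_support_iff _ _).2 ha)]

theorem runFor_nil (T : ℕ) (s : Store) : runFor T ([], s) = PMF.pure ([], s) := by
  induction T with
  | zero => rfl
  | succ T ih => simp [runFor, step, ih]

theorem runFor_add (T T' : ℕ) (c : Config) :
    runFor (T + T') c = (runFor T c).bind (runFor T') := by
  induction T generalizing c with
  | zero => simp [runFor]
  | succ T ih =>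
    rw [Nat.succ_add]
    simp only [runFor, PMF.bind_bind]
    exact pmf_bind_congr _ fun z _ => ih z

/-- The machine started in `c` halts within `T` steps, whatever the random choices. -/
def Halts (c : Config) (T : ℕ) : Prop := ∀ z ∈ (runFor T c).support, z.1 = []

/-- A halted configuration is stationary, so any time budget beyond the halting time gives the same
law. This makes generous step bounds harmless. -/
theorem Halts.runFor_eq {c : Config} {T : ℕ} (h : Halts c T) {T' : ℕ} (hT : T ≤ T') :
    runFor T' c = runFor T c := by
  obtain ⟨d, rfl⟩ := Nat.exists_eq_add_of_le hT
  rw [runFor_add]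
  conv_rhs => rw [← PMF.bind_pure (runFor T c)]
  refine pmf_bind_congr _ ?_
  rintro ⟨k, s⟩ hz
  have : k = [] := h _ hz
  subst this
  exact runFor_nil _ _

theorem Halts.mono {c : Config} {T T' : ℕ} (h : Halts c T) (hT : T ≤ T') : Halts c T' := by
  intro z hz
  rw [h.runFor_eq hT] at hz
  exact h z hz

/-- A step inspects only the first command, so commands waiting below it are carried along
untouched. -/
theorem step_append (c : Prog) (ks k : List Prog) (s : Store) :
    step (c :: ks ++ k, s) = (step (c :: ks, s)).map fun z => (z.1 ++ k, z.2) := by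
  cases c with
  | cond e c d => by_cases h : e.val s = 0 <;> simp [step, PMF.pure_map, h]
  | loop e c => by_cases h : e.val s = 0 <;> simp [step, PMF.pure_map, h]
  | _ => simp [step, PMF.pure_map, PMF.map_comp, Function.comp_def]

theorem Halts.of_succ {c : Config} {T : ℕ} (h : Halts c (T + 1)) {z : Config}
    (hz : z ∈ (step c).support) : Halts z T := fun w hw =>
  h w ((PMF.mem_support_bind_iff _ _ _).2 ⟨z, hz, hw⟩)

theorem Halts.append {T₁ T₂ : ℕ} {ks k : List Prog} {s : Store} (h₁ : Halts (ks, s) T₁)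
    (h₂ : ∀ z ∈ (runFor T₁ (ks, s)).support, Halts (k, z.2) T₂) :
    runFor (T₁ + T₂) (ks ++ k, s) = (runFor T₁ (ks, s)).bind fun z => runFor T₂ (k, z.2) := by
  induction T₁ generalizing ks s with
  | zero =>
    have : ks = [] := h₁ (ks, s) (by simp [runFor])
    subst this
    simp [runFor]
  | succ T ih =>
    cases ks with
    | nil =>
      rw [runFor_nil] at h₂ ⊢
      rw [PMF.pure_bind]
      -- The first list has halted early, so its unused steps go to `k`; they change nothing because
      -- `k` halts within `T₂` anyway.
      exact (h₂ ([], s) (by simp)).runFor_eq (by omega)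
    | cons c ks =>
      rw [Nat.succ_add]
      simp only [runFor, step_append, PMF.bind_map, PMF.bind_bind]
      refine pmf_bind_congr _ ?_
      rintro ⟨ks', s'⟩ hz
      exact ih (h₁.of_succ hz) fun w hw =>
        h₂ w ((PMF.mem_support_bind_iff _ _ _).2 ⟨_, hz, hw⟩)

/-! ### Sampling from a set with given probabilities -/

/-- Started in `c`, the machine halts within `T` steps, and it outputs each element of `X` with
probability `1 / W`, and nothing else. -/
def Samples (c : Config) (T : ℕ) (X : Set (List ℕ)) (W : ℕ) : Prop :=
  Halts c T ∧ (∀ l ∈ X, ((runFor T c).map fun z => z.2.output) l = (W : ℝ≥0∞)⁻¹) ∧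
    ∀ l ∉ X, ((runFor T c).map fun z => z.2.output) l = 0

theorem Samples.mono {c : Config} {T T' : ℕ} {X : Set (List ℕ)} {W : ℕ} (h : Samples c T X W)
    (hT : T ≤ T') : Samples c T' X W := by
  refine ⟨h.1.mono hT, ?_⟩
  rw [h.1.runFor_eq hT]
  exact h.2

theorem samples_nil (s : Store) (T : ℕ) : Samples ([], s) T {s.output} 1 := by
  refine ⟨fun z hz => ?_, fun l hl => ?_, fun l hl => ?_⟩
  · rw [runFor_nil] at hz
    simp at hz
    simp [hz]
  · rw [runFor_nil]
    simp only [Set.mem_singleton_iff] at hl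
    simp [PMF.pure_map, hl]
  · rw [runFor_nil]
    simp only [Set.mem_singleton_iff] at hl
    simp [PMF.pure_map, hl]

theorem Samples.of_step {c c' : Config} {T : ℕ} {X : Set (List ℕ)} {W : ℕ}
    (hc : step c = PMF.pure c') (h : Samples c' T X W) : Samples c (T + 1) X W := by
  have : runFor (T + 1) c = runFor T c' := by simp [runFor, hc]
  refine ⟨fun z hz => h.1 z (this ▸ hz), ?_⟩
  rw [this]
  exact h.2

section rules

variable {k : List Prog} {s : Store} {T : ℕ} {X : Set (List ℕ)} {W : ℕ}

theorem Samples.set {x : ℕ} {e : Expr} (h : Samples (k, s.setVar x (e.val s)) T X W) :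
    Samples (.set x e :: k, s) (T + 1) X W := h.of_step rfl

theorem Samples.put {a : ℕ} {i e : Expr}
    (h : Samples (k, s.setArr a (i.val s) (e.val s)) T X W) :
    Samples (.put a i e :: k, s) (T + 1) X W := h.of_step rfl

theorem Samples.seq {c d : Prog} (h : Samples (c :: d :: k, s) T X W) :
    Samples (.seq c d :: k, s) (T + 1) X W := h.of_step rfl

theorem Samples.cond_pos {e : Expr} {c d : Prog} (he : e.val s ≠ 0)
    (h : Samples (c :: k, s) T X W) : Samples (.cond e c d :: k, s) (T + 1) X W :=
  h.of_step (by simp [step, he])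

theorem Samples.cond_zero {e : Expr} {c d : Prog} (he : e.val s = 0)
    (h : Samples (d :: k, s) T X W) : Samples (.cond e c d :: k, s) (T + 1) X W :=
  h.of_step (by simp [step, he])

theorem Samples.loop_pos {e : Expr} {c : Prog} (he : e.val s ≠ 0)
    (h : Samples (c :: .loop e c :: k, s) T X W) : Samples (.loop e c :: k, s) (T + 1) X W :=
  h.of_step (by simp [step, he])

theorem Samples.loop_zero {e : Expr} {c : Prog} (he : e.val s = 0)
    (h : Samples (k, s) T X W) : Samples (.loop e c :: k, s) (T + 1) X W :=
  h.of_step (by simp [step, he])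

/-- Random choices: the branches in which `l` can be output number `R.card`, and all of them have
the same weight `w`. -/
theorem Samples.rand {x N : ℕ} {e : Expr} (hN : e.val s + 1 = N)
    {Y : ℕ → Set (List ℕ)} {V : ℕ → ℕ}
    (h : ∀ r < N, Samples (k, s.setVar x r) T (Y r) (V r))
    (hX : ∀ r < N, Y r ⊆ X)
    (hY : ∀ l ∈ X, ∃ (R : Finset ℕ) (w : ℕ), (∀ r, r ∈ R ↔ r < N ∧ l ∈ Y r) ∧
      (∀ r ∈ R, V r = w) ∧ R.card * W = N * w ∧ 0 < w) :
    Samples (.rand x e :: k, s) (T + 1) X W := by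
  subst hN
  have key : runFor (T + 1) (.rand x e :: k, s) =
      (PMF.uniformOfFintype (Fin (e.val s + 1))).bind
        fun r => runFor T (k, s.setVar x r.val) := by
    simp [runFor, step, PMF.bind_map, Function.comp_def]
  have key2 : ∀ l, ((runFor (T + 1) (.rand x e :: k, s)).map fun z => z.2.output) l =
      ∑ r ∈ Finset.range (e.val s + 1), ((e.val s + 1 : ℕ) : ℝ≥0∞)⁻¹ *
        ((runFor T (k, s.setVar x r)).map fun z => z.2.output) l := by
    intro l
    rw [key, PMF.map_bind, PMF.bind_apply, tsum_fintype, Finset.sum_range]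
    simp [PMF.uniformOfFintype_apply]
  refine ⟨fun z hz => ?_, fun l hl => ?_, fun l hl => ?_⟩
  · rw [key, PMF.mem_support_bind_iff] at hz
    obtain ⟨r, -, hr⟩ := hz
    exact (h r.val r.isLt).1 z hr
  · obtain ⟨R, w, hR, hw, hc, hw0⟩ := hY l hl
    have hsub : R ⊆ Finset.range (e.val s + 1) := fun r hr =>
      Finset.mem_range.2 ((hR r).1 hr).1
    rw [key2, ← Finset.sum_subset hsub, Finset.sum_congr rfl (g := fun _ =>
      ((e.val s + 1 : ℕ) : ℝ≥0∞)⁻¹ * (w : ℝ≥0∞)⁻¹), Finset.sum_const, nsmul_eq_mul]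
    -- The probability of `l` is `R.card / (N * w)`. Positivity of `w` is what lets the hypothesis
    -- `R.card * W = N * w` be turned into inverses in `ℝ≥0∞`.
    · have hc' : (R.card : ℝ≥0∞) * W = ((e.val s + 1 : ℕ) : ℝ≥0∞) * w := by exact_mod_cast hc
      have h0 : (((e.val s + 1) * w : ℕ) : ℝ≥0∞) ≠ 0 := by
        exact_mod_cast (Nat.mul_pos (Nat.succ_pos _) hw0).ne'
      rw [← ENNReal.mul_inv (Or.inr (ENNReal.natCast_ne_top _))
        (Or.inl (ENNReal.natCast_ne_top _)), ← hc']
      apply ENNReal.eq_inv_of_mul_eq_one_left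
      rw [mul_right_comm, ENNReal.mul_inv_cancel]
      · rw [hc']; exact_mod_cast h0
      · exact_mod_cast ENNReal.natCast_ne_top (R.card * W)
    · intro r hr
      rw [(h r ((hR r).1 hr).1).2.1 l ((hR r).1 hr).2, hw r hr]
    · intro r hr hrR
      have hr' := Finset.mem_range.1 hr
      rw [(h r hr').2.2 l fun hl' => hrR ((hR r).2 ⟨hr', hl'⟩), mul_zero]
  · rw [key2]
    refine Finset.sum_eq_zero fun r hr => ?_
    have hr' := Finset.mem_range.1 hr
    rw [(h r hr').2.2 l fun hl' => hl (hX r hr' hl'), mul_zero]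

end rules

/-- The probabilities sum to one, which excludes an infinite set and forces the constant to be the
inverse of the cardinality. Hence neither the constant of proportionality nor the number of outputs
has to be known in advance. -/
theorem isUniformOn_of_const {μ : PMF (List ℕ)} {X : Set (List ℕ)} {c : ℝ≥0∞}
    (h₁ : ∀ l ∈ X, μ l = c) (h₂ : ∀ l ∉ X, μ l = 0) :
    IsUniformOn μ X ∧ (X.ncard : ℝ≥0∞) * c = 1 := by
  have hsum : (X.encard : ℝ≥0∞) * c = 1 := by
    rw [← μ.tsum_coe, ← ENNReal.tsum_set_const, tsum_subtype X fun _ => c]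
    refine tsum_congr fun l => ?_
    by_cases hl : l ∈ X
    · simp [hl, h₁]
    · simp [hl, h₂]
  have hfin : X.Finite := by
    by_contra hinf
    rw [Set.encard_eq_top_iff.2 hinf] at hsum
    by_cases hc : c = 0
    · simp [hc] at hsum
    · simp [ENNReal.top_mul hc] at hsum
  have hcard : (X.ncard : ℝ≥0∞) * c = 1 := by
    rw [← hsum, ← hfin.cast_ncard_eq]
    simp
  refine ⟨⟨hfin, fun l hl => ?_, h₂⟩, hcard⟩
  rw [h₁ l hl]
  exact ENNReal.eq_inv_of_mul_eq_one_left (by rw [mul_comm]; exact hcard)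

theorem Samples.isUniformOn {c : Prog} {l : List ℕ} {T : ℕ} {X : Set (List ℕ)} {W : ℕ}
    (h : Samples ([c], Store.input l) T X W) :
    HaltsWithin c l T ∧ IsUniformOn (outputLaw c l T) X :=
  ⟨h.1, (isUniformOn_of_const h.2.1 h.2.2).1⟩

theorem Store.output_input (l : List ℕ) : (Store.input l).output = l := by
  refine List.ext_getElem (by simp [Store.output, Store.input]) fun i h₁ h₂ => ?_
  simp [Store.output, Store.input, h₂]

/-! ### Sequential composition of programs and its output law. -/

theorem Halts.seq_runFor {c d : Prog} {s : Store} {T₁ T₂ : ℕ} (h₁ : Halts ([c], s) T₁)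
    (h₂ : ∀ z ∈ (runFor T₁ ([c], s)).support, Halts ([d], z.2) T₂) :
    runFor (T₁ + T₂ + 1) ([c.seq d], s) =
      (runFor T₁ ([c], s)).bind fun z => runFor T₂ ([d], z.2) := by
  rw [← h₁.append h₂]
  simp [runFor, step]

theorem Halts.seq {c d : Prog} {s : Store} {T₁ T₂ : ℕ} (h₁ : Halts ([c], s) T₁)
    (h₂ : ∀ z ∈ (runFor T₁ ([c], s)).support, Halts ([d], z.2) T₂) :
    Halts ([c.seq d], s) (T₁ + T₂ + 1) := by
  intro z hz
  rw [h₁.seq_runFor h₂, PMF.mem_support_bind_iff] at hz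
  obtain ⟨y, hy, hz⟩ := hz
  exact h₂ y hy z hz

/-- If `d` outputs `l` with probability `w` when started on the output `o` of `c`, and never when
started on another output of `c`, then `c` followed by `d` outputs `l` with probability `w` times
that of `c` for `o`. -/
theorem Halts.seq_output_apply {c d : Prog} {s : Store} {T₁ T₂ : ℕ} (h₁ : Halts ([c], s) T₁)
    (h₂ : ∀ z ∈ (runFor T₁ ([c], s)).support, Halts ([d], z.2) T₂) {l o : List ℕ} {w : ℝ≥0∞}
    (hw : ∀ z ∈ (runFor T₁ ([c], s)).support,
      ((runFor T₂ ([d], z.2)).map fun y => y.2.output) l = if z.2.output = o then w else 0) :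
    ((runFor (T₁ + T₂ + 1) ([c.seq d], s)).map fun y => y.2.output) l =
      ((runFor T₁ ([c], s)).map fun z => z.2.output) o * w := by
  rw [h₁.seq_runFor h₂, PMF.map_bind, PMF.bind_apply, PMF.map_apply, ← ENNReal.tsum_mul_right]
  refine tsum_congr fun z => ?_
  by_cases hz : (runFor T₁ ([c], s)) z = 0
  · simp [hz]
  · rw [hw z ((PMF.mem_support_iff _ _).2 hz)]
    by_cases ho : z.2.output = o
    · simp [ho]
    · simp [ho, Ne.symm ho]

theorem mem_support_output {c : Config} {T : ℕ} {z : Config} (hz : z ∈ (runFor T c).support) :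
    ((runFor T c).map fun z => z.2.output) z.2.output ≠ 0 := by
  rw [← PMF.mem_support_iff, PMF.mem_support_map_iff]
  exact ⟨z, hz, rfl⟩

theorem Samples.output_mem {c : Config} {T : ℕ} {X : Set (List ℕ)} {W : ℕ}
    (h : Samples c T X W) {z : Config} (hz : z ∈ (runFor T c).support) : z.2.output ∈ X := by
  by_contra hX
  exact mem_support_output hz (h.2.2 _ hX)

/-! ### Motzkin paths from an arbitrary starting height -/

/-- The height after the move `m` from height `h`. -/
def Move.next (h : ℕ) : Move → ℕ
  | U => h + 1
  | H => h
  | D => h - 1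

/-- The height of the move `m` from height `h`. -/
def Move.level (h : ℕ) : Move → ℕ
  | U => h + 1
  | H => h
  | D => h

/-- The path, started at height `h`, ends at height `0` and never goes below it. -/
def Descends : ℕ → List Move → Prop
  | h, [] => h = 0
  | h, .U :: mz => Descends (h + 1) mz
  | h, .H :: mz => Descends h mz
  | h, .D :: mz => 0 < h ∧ Descends (h - 1) mz

/-- The number of moves `m` of height `i` in the path, started at height `h`. -/
def countFrom : ℕ → List Move → Move → ℕ → ℕ
  | _, [], _, _ => 0
  | h, x :: mz, m, i => (if x = m ∧ i = x.level h then 1 else 0) + countFrom (x.next h) mz m i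

/-- Twice the area below the path, started at height `h`. -/
def areaFrom : ℕ → List Move → ℕ
  | _, [] => 0
  | h, x :: mz => h + x.next h + areaFrom (x.next h) mz

theorem height_zero (mz : List Move) : height mz 0 = 0 := by simp [height]

theorem height_cons_succ (x : Move) (mz : List Move) (k : ℕ) :
    height (x :: mz) (k + 1) = x.rise + height mz k := by simp [height]

theorem descends_cons {h : ℕ} {x : Move} {mz : List Move} :
    Descends h (x :: mz) ↔ ((x.next h : ℕ) : ℤ) = h + x.rise ∧ Descends (x.next h) mz := by
  cases x
  · simp [Descends, Move.next, Move.rise]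
  · simp [Descends, Move.next, Move.rise]
  · simp only [Descends, Move.next, Move.rise]
    refine and_congr_left fun _ => ?_
    omega

/-- The prefix-sum description of a path does not lend itself to induction on the list; the
recursive one, with a free starting height, does. This lemma and the next two translate between
them. -/
theorem descends_iff (h : ℕ) (mz : List Move) :
    Descends h mz ↔ (∀ k ≤ mz.length, 0 ≤ (h : ℤ) + height mz k) ∧
      (h : ℤ) + height mz mz.length = 0 := by
  induction mz generalizing h with
  | nil => simp [Descends, height]
  | cons x mz ih =>
    rw [descends_cons, ih]
    simp only [List.length_cons, height_cons_succ]
    constructor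
    · rintro ⟨h₁, h₂, h₃⟩
      refine ⟨fun k hk => ?_, by omega⟩
      cases k with
      | zero => simp [height_zero]
      | succ k =>
        have := h₂ k (by omega)
        rw [height_cons_succ]
        omega
    · rintro ⟨h₁, h₂⟩
      have h₀ := h₁ 1 (by omega)
      rw [height_cons_succ x mz 0, height_zero] at h₀
      have hx : ((x.next h : ℕ) : ℤ) = h + x.rise := by
        cases x <;> simp [Move.next, Move.rise] at h₀ ⊢
        omega
      refine ⟨hx, fun k hk => ?_, by omega⟩
      have := h₁ (k + 1) (by omega)
      rw [height_cons_succ] at this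
      omega

theorem sum_height_eq_areaFrom {h : ℕ} {mz : List Move} (hd : Descends h mz) :
    ∑ k ∈ Finset.range mz.length, (((h : ℤ) + height mz k) + (h + height mz (k + 1))) =
      areaFrom h mz := by
  induction mz generalizing h with
  | nil => simp [areaFrom]
  | cons x mz ih =>
    obtain ⟨hx, hd⟩ := descends_cons.1 hd
    have := ih hd
    rw [List.length_cons, Finset.sum_range_succ']
    simp only [height_cons_succ, height_zero, areaFrom, Nat.cast_add, hx] at this ⊢
    rw [← this, add_comm]
    congr 1
    · ring
    · exact Finset.sum_congr rfl fun k _ => by ring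

theorem card_filter_eq_countFrom {h : ℕ} {mz : List Move} (hd : Descends h mz) (m : Move)
    (i : ℕ) :
    ((Finset.range mz.length).filter fun k => mz[k]? = some m ∧
      max ((h : ℤ) + height mz k) (h + height mz (k + 1)) = i).card = countFrom h mz m i := by
  induction mz generalizing h with
  | nil => simp [countFrom]
  | cons x mz ih =>
    obtain ⟨hx, hd⟩ := descends_cons.1 hd
    have := ih hd
    rw [Finset.card_filter] at this ⊢
    rw [List.length_cons, Finset.sum_range_succ']
    simp only [height_cons_succ, height_zero, countFrom, hx, List.getElem?_cons_succ,
      List.getElem?_cons_zero, Option.some.injEq] at this ⊢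
    rw [← this, add_comm]
    congr 1
    · refine if_congr (and_congr_right fun _ => ?_) rfl rfl
      cases x <;> simp [Move.level, Move.rise] <;> omega
    · exact Finset.sum_congr rfl fun k _ => by simp only [add_assoc]

theorem mem_MZ {n A : ℕ} {mz : List Move} :
    mz ∈ MZ n A ↔ mz.length = n ∧ Descends 0 mz ∧ areaFrom 0 mz = 2 * A := by
  have key := descends_iff 0 mz
  simp only [Nat.cast_zero, zero_add] at key
  constructor
  · rintro ⟨rfl, h₁, h₂, h₃⟩
    have hd := key.2 ⟨h₁, h₂⟩
    have := sum_height_eq_areaFrom hd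
    simp only [Nat.cast_zero, zero_add] at this
    exact ⟨rfl, hd, by rw [h₃] at this; exact_mod_cast this.symm⟩
  · rintro ⟨rfl, hd, h₃⟩
    have := sum_height_eq_areaFrom hd
    simp only [Nat.cast_zero, zero_add] at this
    exact ⟨rfl, (key.1 hd).1, (key.1 hd).2, by rw [this, h₃]; push_cast; rfl⟩

theorem moveCount_eq {mz : List Move} (hd : Descends 0 mz) (m : Move) (i : ℕ) :
    moveCount mz m i = countFrom 0 mz m i := by
  rw [← card_filter_eq_countFrom hd, moveCount]
  refine congrArg Finset.card (Finset.filter_congr fun k _ => ?_)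
  simp [moveHeight]

/-- Every ascent to height `i` is undone by a descent, and a path started at `h` crosses each of the
levels `1, …, h` downwards once more. So the moves `D` need not be recorded. -/
theorem countFrom_D {h : ℕ} {mz : List Move} (hd : Descends h mz) (i : ℕ) :
    countFrom h mz .D i = countFrom h mz .U i + if 1 ≤ i ∧ i ≤ h then 1 else 0 := by
  induction mz generalizing h with
  | nil =>
    simp only [Descends] at hd
    subst hd
    simp only [countFrom]
    rw [if_neg (by omega)]
  | cons x mz ih =>
    cases x with
    | U =>
      simp only [countFrom, Move.level, reduceCtorEq, false_and, if_false, true_and]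
      rw [show Move.U.next h = h + 1 from rfl, ih (h := h + 1) hd]
      split_ifs <;> omega
    | H =>
      simp only [countFrom, Move.level, reduceCtorEq, false_and, if_false]
      rw [show Move.H.next h = h from rfl, ih (h := h) hd]
      omega
    | D =>
      have h₀ : 0 < h := hd.1
      simp only [countFrom, Move.level, reduceCtorEq, false_and, if_false, true_and]
      rw [show Move.D.next h = h - 1 from rfl, ih (h := h - 1) hd.2]
      split_ifs <;> omega

theorem countFrom_U_zero (h : ℕ) (mz : List Move) : countFrom h mz .U 0 = 0 := by
  induction mz generalizing h with
  | nil => rfl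
  | cons x mz ih => cases x <;> simp [countFrom, ih, Move.level]

/-- A height that is not reached by a move `U` is not exceeded. -/
theorem countFrom_eq_zero {h i : ℕ} {mz : List Move} (hd : Descends h mz) (hi : h < i)
    (hu : countFrom h mz .U i = 0) :
    countFrom h mz .H i = 0 ∧ countFrom h mz .U (i + 1) = 0 := by
  induction mz generalizing h with
  | nil => simp [countFrom]
  | cons x mz ih =>
    have hx := descends_cons.1 hd
    simp only [countFrom, Nat.add_eq_zero_iff] at hu ⊢
    have hn : x.next h < i := by
      cases x <;> simp [Move.next, Move.level] at hu ⊢ <;> omega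
    obtain ⟨h₁, h₂⟩ := ih hx.2 hn hu.2
    refine ⟨⟨?_, h₁⟩, ?_, h₂⟩ <;> cases x <;> simp [Move.level] <;> omega

/-- `h`, `f`, `u` give the starting height, the numbers of moves `H`, and the numbers of moves `U`
of each height of the path. -/
def Completes (h : ℕ) (f u : ℕ → ℕ) (mz : List Move) : Prop :=
  Descends h mz ∧ (∀ i, countFrom h mz .H i = f i) ∧ ∀ i, countFrom h mz .U i = u i

theorem completes_nil {h : ℕ} {f u : ℕ → ℕ} :
    Completes h f u [] ↔ h = 0 ∧ (∀ i, f i = 0) ∧ ∀ i, u i = 0 := by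
  simp [Completes, Descends, countFrom, eq_comm]

/-- Making a move of height `j` means decreasing the stock `g` at `j` by one, which requires it to
be positive. This turns the counting conditions into a recursion on the first move. -/
theorem forall_ite_add_eq_iff (c g : ℕ → ℕ) (j : ℕ) :
    (∀ i, (if i = j then 1 else 0) + c i = g i) ↔
      0 < g j ∧ ∀ i, c i = Function.update g j (g j - 1) i := by
  constructor
  · intro h
    refine ⟨by have := h j; simp at this; omega, fun i => ?_⟩
    have := h i
    by_cases hi : i = j
    · subst hi; simp at this ⊢; omega
    · simpa [hi] using this
  · rintro ⟨h₀, h⟩ i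
    have := h i
    by_cases hi : i = j
    · subst hi; simp at this ⊢; omega
    · simpa [hi] using this

theorem completes_H {h : ℕ} {f u : ℕ → ℕ} {mz : List Move} :
    Completes h f u (.H :: mz) ↔
      0 < f h ∧ Completes h (Function.update f h (f h - 1)) u mz := by
  simp only [Completes, Descends, countFrom, Move.level, Move.next, true_and, reduceCtorEq,
    false_and, if_false, zero_add, forall_ite_add_eq_iff]
  tauto

theorem completes_U {h : ℕ} {f u : ℕ → ℕ} {mz : List Move} :
    Completes h f u (.U :: mz) ↔
      0 < u (h + 1) ∧ Completes (h + 1) f (Function.update u (h + 1) (u (h + 1) - 1)) mz := by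
  simp only [Completes, Descends, countFrom, Move.level, Move.next, true_and, reduceCtorEq,
    false_and, if_false, zero_add, forall_ite_add_eq_iff]
  tauto

theorem completes_D {h : ℕ} {f u : ℕ → ℕ} {mz : List Move} :
    Completes h f u (.D :: mz) ↔ 0 < h ∧ Completes (h - 1) f u mz := by
  simp only [Completes, Descends, countFrom, Move.next, reduceCtorEq,
    false_and, if_false, zero_add]
  tauto

/-! ### Width, area and number of labelings as functions of the counts of moves. -/

theorem sum_ite_add {K j : ℕ} (hj : j < K) (w c : ℕ → ℕ) :
    ∑ i ∈ Finset.range K, w i * ((if i = j then 1 else 0) + c i) =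
      w j + ∑ i ∈ Finset.range K, w i * c i := by
  simp [mul_add, Finset.sum_add_distrib, hj]

theorem prod_ite_add {K j : ℕ} (hj : j < K) (w c : ℕ → ℕ) :
    ∏ i ∈ Finset.range K, w i ^ ((if i = j then 1 else 0) + c i) =
      w j * ∏ i ∈ Finset.range K, w i ^ c i := by
  simp only [pow_add, Finset.prod_mul_distrib]
  congr 1
  rw [Finset.prod_eq_single j] <;> simp +contextual [hj]

theorem lt_of_countFrom_cons {h K : ℕ} {x : Move} {mz : List Move} (hK : h < K)
    (hu : ∀ i, K ≤ i → countFrom h (x :: mz) .U i = 0) :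
    x.next h < K ∧ x.level h < K ∧ ∀ i, K ≤ i → countFrom (x.next h) mz .U i = 0 := by
  have h₂ : x.level h < K := by
    by_contra hc
    have := hu _ (not_lt.1 hc)
    cases x <;> simp [countFrom, Move.level] at this hc <;> omega
  refine ⟨?_, h₂, fun i hi => ?_⟩
  · cases x <;> simp [Move.next, Move.level] at h₂ ⊢ <;> omega
  · have := hu i hi
    rw [countFrom] at this
    omega

theorem sum_countFrom_eq_length {h K : ℕ} {mz : List Move} (hd : Descends h mz) (hK : h < K)
    (hu : ∀ i, K ≤ i → countFrom h mz .U i = 0) :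
    ∑ i ∈ Finset.range K, 1 * countFrom h mz .H i +
      2 * ∑ i ∈ Finset.range K, 1 * countFrom h mz .U i + h = mz.length := by
  induction mz generalizing h with
  | nil => simpa [countFrom, Descends] using hd
  | cons x mz ih =>
    obtain ⟨h₁, h₂, h₃⟩ := lt_of_countFrom_cons hK hu
    have := ih (descends_cons.1 hd).2 h₁ h₃
    rw [List.length_cons, ← this]
    cases x
    · simp only [countFrom, Move.next, Move.level, reduceCtorEq, false_and, if_false,
        true_and, zero_add] at h₂ ⊢
      rw [sum_ite_add h₂]
      omega
    · simp only [countFrom, Move.next, Move.level, reduceCtorEq, false_and, if_false,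
        true_and, zero_add] at h₂ ⊢
      rw [sum_ite_add h₂]
      omega
    · simp only [countFrom, Move.next, reduceCtorEq, false_and, if_false, zero_add]
      have := hd.1
      omega

/-- An `H` of height `i` contributes `2 * i` to twice the area, and a `U` or `D` of height `i`
contributes `2 * i - 1`. The unmatched descents from `h` add `1 + 3 + ⋯ + (2 * h - 1) = h * h`. -/
theorem sum_countFrom_eq_area {h K : ℕ} {mz : List Move} (hd : Descends h mz) (hK : h < K)
    (hu : ∀ i, K ≤ i → countFrom h mz .U i = 0) :
    2 * ∑ i ∈ Finset.range K, i * countFrom h mz .H i +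
      2 * ∑ i ∈ Finset.range K, (2 * i - 1) * countFrom h mz .U i + h * h = areaFrom h mz := by
  induction mz generalizing h with
  | nil => simpa [countFrom, areaFrom, Descends] using hd
  | cons x mz ih =>
    obtain ⟨h₁, h₂, h₃⟩ := lt_of_countFrom_cons hK hu
    have := ih (descends_cons.1 hd).2 h₁ h₃
    rw [areaFrom, ← this]
    cases x
    · simp only [countFrom, Move.next, Move.level, reduceCtorEq, false_and, if_false,
        true_and, zero_add] at h₂ ⊢
      rw [sum_ite_add h₂ fun i => 2 * i - 1]
      have : 2 * (h + 1) - 1 = 2 * h + 1 := by omega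
      rw [this]
      ring
    · simp only [countFrom, Move.next, Move.level, reduceCtorEq, false_and, if_false,
        true_and, zero_add] at h₂ ⊢
      rw [sum_ite_add h₂ fun i => i]
      ring
    · simp only [countFrom, Move.next, reduceCtorEq, false_and, if_false, zero_add]
      obtain ⟨g, rfl⟩ := Nat.exists_eq_add_of_le hd.1
      rw [Nat.add_sub_cancel_left]
      ring

/-- The number of ways in which the moves of the path, started at height `h`, can be labelled to
get a permutation. -/
def labelings : ℕ → List Move → ℕ
  | _, [] => 1
  | h, .U :: mz => labelings (h + 1) mz
  | h, .H :: mz => (2 * h + 1) * labelings h mz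
  | h, .D :: mz => h * h * labelings (h - 1) mz

theorem labelings_pos {h : ℕ} {mz : List Move} (hd : Descends h mz) : 0 < labelings h mz := by
  induction mz generalizing h with
  | nil => simp [labelings]
  | cons x mz ih =>
    have := ih (descends_cons.1 hd).2
    cases x
    · exact this
    · exact Nat.mul_pos (by omega) this
    · exact Nat.mul_pos (Nat.mul_pos hd.1 hd.1) this

/-- All factors `i * i` come from the moves `D`. There is one such move for each `U` of the same
height, and one more for each level `1, …, h`, which accounts for the square of the factorial. -/
theorem labelings_eq {h K : ℕ} {mz : List Move} (hd : Descends h mz) (hK : h < K)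
    (hu : ∀ i, K ≤ i → countFrom h mz .U i = 0) :
    labelings h mz = (∏ i ∈ Finset.range K, (2 * i + 1) ^ countFrom h mz .H i) *
      (∏ i ∈ Finset.range K, (i ^ 2) ^ countFrom h mz .U i) * h.factorial ^ 2 := by
  induction mz generalizing h with
  | nil =>
    simp only [Descends] at hd
    simp [countFrom, labelings, hd]
  | cons x mz ih =>
    obtain ⟨h₁, h₂, h₃⟩ := lt_of_countFrom_cons hK hu
    have := ih (descends_cons.1 hd).2 h₁ h₃
    cases x
    · simp only [countFrom, Move.next, Move.level, reduceCtorEq, false_and, if_false,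
        true_and, zero_add, labelings] at h₂ this ⊢
      rw [prod_ite_add h₂ fun i => i ^ 2, this, Nat.factorial_succ]
      ring
    · simp only [countFrom, Move.next, Move.level, reduceCtorEq, false_and, if_false,
        true_and, zero_add, labelings] at h₂ this ⊢
      rw [prod_ite_add h₂ fun i => 2 * i + 1, this]
      ring
    · simp only [countFrom, Move.next, reduceCtorEq, false_and, if_false, zero_add,
        labelings] at this ⊢
      obtain ⟨g, rfl⟩ := Nat.exists_eq_add_of_le hd.1
      rw [Nat.add_sub_cancel_left] at this ⊢
      rw [this, add_comm 1 g, Nat.factorial_succ]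
      ring

/-! ### Building sequences and paths -/

theorem peaks_zero (a : List ℕ) : peaks a 0 = 0 := rfl

section sequences

variable {n A : ℕ} {a : List ℕ}

theorem flats_eq_zero (ha : a ∈ S n A) {i : ℕ} (hi : top a < i) : flats a i = 0 := by
  have := ha.1
  simp only [flats, List.getD_eq_getElem?_getD]
  rw [List.getElem?_eq_none (by omega)]
  rfl

theorem peaks_eq_zero (ha : a ∈ S n A) {i : ℕ} (hi : top a < i) : peaks a i = 0 := by
  have := ha.1
  rw [peaks, if_neg (by omega), List.getD_eq_getElem?_getD, List.getElem?_eq_none (by omega)]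
  rfl

theorem peaks_pos_iff (ha : a ∈ S n A) {i : ℕ} : 0 < peaks a i ↔ 1 ≤ i ∧ i ≤ top a := by
  constructor
  · intro h
    constructor
    · by_contra hi
      obtain rfl : i = 0 := by omega
      simp [peaks] at h
    · by_contra hi
      rw [peaks_eq_zero ha (by omega)] at h
      omega
  · intro h
    exact ha.2.1 i (Finset.mem_Icc.2 h)

theorem sum_Icc_eq_sum_range (g : ℕ → ℕ) (hg : g 0 = 0) (t : ℕ) :
    ∑ i ∈ Finset.Icc 1 t, g i = ∑ i ∈ Finset.range (t + 1), g i := by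
  rw [Finset.range_eq_Ico, Finset.sum_eq_sum_Ico_succ_bot (Nat.succ_pos t), hg, zero_add]
  rfl

theorem prod_Icc_eq_prod_range (g : ℕ → ℕ) (hg : g 0 = 1) (t : ℕ) :
    ∏ i ∈ Finset.Icc 1 t, g i = ∏ i ∈ Finset.range (t + 1), g i := by
  rw [Finset.range_eq_Ico, Finset.prod_eq_prod_Ico_succ_bot (Nat.succ_pos t), hg, one_mul]
  rfl

/-- From height `0` there are no unmatched descents, so the condition on the moves `D` follows from
that on the moves `U`. -/
theorem builtFrom_iff {mz : List Move} (hd : Descends 0 mz) :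
    BuiltFrom a mz ↔ Completes 0 (flats a) (peaks a) mz := by
  simp only [BuiltFrom, Completes, moveCount_eq hd, hd, true_and, countFrom_D hd]
  constructor
  · intro h
    exact ⟨fun i => (h i).1, fun i => (h i).2.1⟩
  · rintro ⟨h₁, h₂⟩ i
    refine ⟨h₁ i, h₂ i, ?_⟩
    rw [h₂ i, if_neg (by omega), add_zero]

/-- The total width and the total area of a path that is built from given moves. -/
theorem length_and_area_of_completes {K : ℕ} {f u : ℕ → ℕ} {mz : List Move}
    (h : Completes 0 f u mz) (hu : ∀ i, K < i → u i = 0) :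
    mz.length = ∑ i ∈ Finset.range (K + 1), f i + 2 * ∑ i ∈ Finset.Icc 1 K, u i ∧
    areaFrom 0 mz = 2 * (∑ i ∈ Finset.range (K + 1), i * f i +
      ∑ i ∈ Finset.Icc 1 K, (2 * i - 1) * u i) := by
  have hu' : ∀ i, K + 1 ≤ i → countFrom 0 mz .U i = 0 := fun i hi => by
    rw [h.2.2, hu i hi]
  have hu0 : u 0 = 0 := by rw [← h.2.2, countFrom_U_zero]
  have h₁ := sum_countFrom_eq_length (K := K + 1) h.1 (Nat.succ_pos K) hu'
  have h₂ := sum_countFrom_eq_area (K := K + 1) h.1 (Nat.succ_pos K) hu'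
  simp only [h.2.1, h.2.2, one_mul] at h₁ h₂
  rw [sum_Icc_eq_sum_range u hu0, sum_Icc_eq_sum_range (fun i => (2 * i - 1) * u i) (by simp [hu0])]
  constructor <;> omega

/-- Width and area are determined by the counts of moves, so every path with the right counts
automatically lies in `MZ n A`. -/
theorem mem_MZ_and_builtFrom_iff (ha : a ∈ S n A) {mz : List Move} :
    mz ∈ MZ n A ∧ BuiltFrom a mz ↔ Completes 0 (flats a) (peaks a) mz := by
  constructor
  · rintro ⟨h₁, h₂⟩
    exact (builtFrom_iff (mem_MZ.1 h₁).2.1).1 h₂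
  · intro h
    obtain ⟨h₁, h₂⟩ := length_and_area_of_completes h fun i => peaks_eq_zero ha
    exact ⟨mem_MZ.2 ⟨h₁.trans ha.2.2.1, h.1, by rw [h₂, ha.2.2.2]⟩, (builtFrom_iff h.1).2 h⟩

theorem labelings_eq_perm (ha : a ∈ S n A) {mz : List Move} (h : BuiltFrom a mz)
    (hmz : mz ∈ MZ n A) : labelings 0 mz = perm a := by
  have hc := (mem_MZ_and_builtFrom_iff ha).1 ⟨hmz, h⟩
  rw [labelings_eq hc.1 (Nat.succ_pos (top a)) fun i hi => by
    rw [hc.2.2, peaks_eq_zero ha hi]]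
  simp only [hc.2.1, hc.2.2, Nat.factorial_zero, one_pow, mul_one, perm, ← pow_mul]
  congr 1
  exact (prod_Icc_eq_prod_range (fun i => i ^ (2 * peaks a i)) (by simp [peaks_zero]) _).symm

theorem getD_eq (a : List ℕ) (j : ℕ) :
    a.getD j 0 = if j % 2 = 0 then flats a (j / 2) else peaks a ((j + 1) / 2) := by
  split_ifs with h
  · rw [flats]; congr 1; omega
  · rw [peaks, if_neg (by omega)]; congr 1; omega

/-- The path determines all the entries, and it determines the length as well: the requirement that
the peaks up to the top be positive rules out padding with zeros. -/
theorem eq_of_builtFrom {n' A' : ℕ} {a' : List ℕ} (ha : a ∈ S n A) (ha' : a' ∈ S n' A')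
    {mz : List Move} (h : BuiltFrom a mz) (h' : BuiltFrom a' mz) : a = a' := by
  have hf : ∀ i, flats a i = flats a' i := fun i => (h i).1.symm.trans (h' i).1
  have hp : ∀ i, peaks a i = peaks a' i := fun i => (h i).2.1.symm.trans (h' i).2.1
  have ht : top a = top a' := by
    have h₁ : ∀ i, 1 ≤ i ∧ i ≤ top a ↔ 1 ≤ i ∧ i ≤ top a' := fun i => by
      rw [← peaks_pos_iff ha, ← peaks_pos_iff ha', hp]
    have := h₁ (top a)
    have := h₁ (top a')
    omega
  refine List.ext_getElem (by rw [ha.1, ha'.1, ht]) fun j h₁ h₂ => ?_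
  rw [← List.getD_eq_getElem a 0 h₁, ← List.getD_eq_getElem a' 0 h₂, getD_eq, getD_eq, hf, hp]

/-- A path cannot skip a height, so the heights reached by a `U` are exactly `1, …, t`, where `t` is
the first height with no `U` to `t + 1`. The counts of moves up to `t` form the sequence. -/
theorem exists_builtFrom {mz : List Move} (hmz : mz ∈ MZ n A) : ∃ a ∈ S n A, BuiltFrom a mz := by
  obtain ⟨hl, hd, hA⟩ := mem_MZ.1 hmz
  set f := countFrom 0 mz .H with hf
  set u := countFrom 0 mz .U with hu
  have hstep : ∀ i, 0 < i → u i = 0 → f i = 0 ∧ u (i + 1) = 0 := fun i hi => countFrom_eq_zero hd hi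
  -- A path cannot rise by more than its length; this guarantees that the search for `t` ends.
  have hbound : ∀ (h : ℕ) (l : List Move) (i : ℕ), h + l.length < i → countFrom h l .U i = 0 := by
    intro h l
    induction l generalizing h with
    | nil => intro i _; rfl
    | cons x l ih =>
      intro i hi
      rw [List.length_cons] at hi
      rw [countFrom, ih _ i (by cases x <;> simp [Move.next] <;> omega)]
      cases x <;> simp [Move.level] <;> omega
  have hex : ∃ t, u (t + 1) = 0 := ⟨mz.length, hbound 0 mz _ (by omega)⟩
  classical
  set t := Nat.find hex with ht
  have hzero : ∀ i, t < i → u i = 0 := by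
    intro i hi
    obtain ⟨d, rfl⟩ := Nat.exists_eq_add_of_lt hi
    induction d with
    | zero => exact Nat.find_spec hex
    | succ d ih => exact (hstep _ (by omega) (ih (by omega))).2
  have hzero' : ∀ i, t < i → f i = 0 := fun i hi => (hstep i (by omega) (hzero i hi)).1
  have hpos : ∀ i, 1 ≤ i → i ≤ t → 0 < u i := by
    intro i h₁ h₂
    have := Nat.find_min hex (m := i - 1) (by omega)
    rw [Nat.sub_add_cancel h₁] at this
    omega
  set a : List ℕ := (List.range (2 * t + 1)).map
    fun j => if j % 2 = 0 then f (j / 2) else u ((j + 1) / 2) with ha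
  have hlen : a.length = 2 * t + 1 := by simp [ha]
  have htop : top a = t := by rw [top, hlen]; omega
  have hget : ∀ j, j < 2 * t + 1 →
      a.getD j 0 = if j % 2 = 0 then f (j / 2) else u ((j + 1) / 2) := by
    intro j hj
    rw [List.getD_eq_getElem _ _ (by omega)]
    simp [ha]
  have hflats : ∀ i, flats a i = f i := by
    intro i
    rcases le_or_gt i t with hi | hi
    · rw [flats, hget _ (by omega), if_pos (by omega)]
      congr 1; omega
    · rw [hzero' i hi, flats, List.getD_eq_getElem?_getD, List.getElem?_eq_none (by omega)]
      rfl
  have hpeaks : ∀ i, peaks a i = u i := by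
    intro i
    by_cases h0 : i = 0
    · rw [h0, peaks_zero, hu, countFrom_U_zero]
    rcases le_or_gt i t with hi | hi
    · rw [peaks, if_neg h0, hget _ (by omega), if_neg (by omega)]
      congr 1; omega
    · rw [hzero i hi, peaks, if_neg h0, List.getD_eq_getElem?_getD,
        List.getElem?_eq_none (by omega)]
      rfl
  have hc : Completes 0 (flats a) (peaks a) mz :=
    ⟨hd, fun i => (hflats i).symm, fun i => (hpeaks i).symm⟩
  obtain ⟨h₁, h₂⟩ := length_and_area_of_completes (K := t) hc
    fun i hi => by rw [hpeaks, hzero i hi]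
  refine ⟨a, ⟨by rw [htop, hlen], ?_, ?_, ?_⟩, (builtFrom_iff hd).2 hc⟩
  · intro i hi
    rw [htop, Finset.mem_Icc] at hi
    rw [hpeaks]
    exact hpos i hi.1 hi.2
  · rw [htop, ← h₁, hl]
  · rw [htop]
    omega

end sequences

/-! ### The memory -/

section store

variable (s : Store) (x y a b i j v : ℕ)

@[simp] theorem Store.setVar_var :
    (s.setVar x v).var y = if y = x then v else s.var y := by
  simp [Store.setVar, Function.update_apply]

@[simp] theorem Store.setVar_arr : (s.setVar x v).arr = s.arr := rfl

@[simp] theorem Store.setArr_var : (s.setArr a i v).var = s.var := rfl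

@[simp] theorem Store.setArr_arr :
    (s.setArr a i v).arr b j = if b = a ∧ j = i then v else s.arr b j := by
  by_cases hb : b = a
  · subst hb; simp [Store.setArr, Function.update_apply]
  · simp [Store.setArr, hb]

end store

theorem Store.output_snoc {s s' : Store} {c : ℕ} (h₀ : s'.var 0 = s.var 0 + 1)
    (h₁ : ∀ j < s.var 0, s'.arr 0 j = s.arr 0 j) (h₂ : s'.arr 0 (s.var 0) = c) :
    s'.output = s.output ++ [c] := by
  rw [Store.output, Store.output, h₀, List.range_succ, List.map_append, List.map_singleton, h₂]
  congr 1
  exact List.map_congr_left fun j hj => h₁ j (List.mem_range.1 hj)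

theorem Store.output_eq_iff {s : Store} {l : List ℕ} :
    s.output = l ↔ s.var 0 = l.length ∧ ∀ j < l.length, s.arr 0 j = l.getD j 0 := by
  constructor
  · rintro rfl
    refine ⟨by simp [Store.output], fun j hj => ?_⟩
    rw [List.getD_eq_getElem _ _ hj]
    simp [Store.output]
  · rintro ⟨h₁, h₂⟩
    refine List.ext_getElem (by simp [Store.output, h₁]) fun j hj hj' => ?_
    rw [← List.getD_eq_getElem _ 0 hj', ← h₂ j hj']
    simp [Store.output]

theorem pathCode_injective : Function.Injective pathCode :=
  List.map_injective_iff.2 fun m m' h => by cases m <;> cases m' <;> simp [Move.code] at h ⊢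

/-! ### Counting the completions of a path -/

/-- The trinomial coefficient `(x + y + z)! / (x! y! z!)`. -/
def trinomial (x y z : ℕ) : ℕ := (x + y + z).choose x * (y + z).choose y

theorem trinomial_mul_factorial (x y z : ℕ) :
    trinomial x y z * (x.factorial * y.factorial * z.factorial) = (x + y + z).factorial := by
  have h₁ := Nat.choose_mul_factorial_mul_factorial (n := x + (y + z)) (k := x) (by omega)
  have h₂ := Nat.choose_mul_factorial_mul_factorial (n := y + z) (k := y) (by omega)
  rw [Nat.add_sub_cancel_left] at h₁ h₂
  rw [trinomial, add_assoc, ← h₁, ← h₂]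
  ring

theorem trinomial_pos (x y z : ℕ) : 0 < trinomial x y z :=
  Nat.mul_pos (Nat.choose_pos (by omega)) (Nat.choose_pos (by omega))

/-- This and its two companions give the ratio of two trinomial coefficients when one object of a
kind is used up: the probability that an object of this kind comes first in a uniformly random
arrangement. -/
theorem trinomial_left (x y z : ℕ) :
    trinomial (x + 1) y z * (x + 1) = (x + 1 + y + z) * trinomial x y z := by
  have h₁ := trinomial_mul_factorial (x + 1) y z
  have h₂ := trinomial_mul_factorial x y z
  have h₃ : x + 1 + y + z = x + y + z + 1 := by ring
  have h₄ : 0 < x.factorial * y.factorial * z.factorial := by positivity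
  rw [h₃, Nat.factorial_succ (_ + _), ← h₂, Nat.factorial_succ, ← h₃] at h₁
  exact Nat.eq_of_mul_eq_mul_right h₄ (by linarith)

theorem trinomial_mid (x y z : ℕ) :
    trinomial x (y + 1) z * (y + 1) = (x + (y + 1) + z) * trinomial x y z := by
  have h₁ := trinomial_mul_factorial x (y + 1) z
  have h₂ := trinomial_mul_factorial x y z
  have h₃ : x + (y + 1) + z = x + y + z + 1 := by ring
  have h₄ : 0 < x.factorial * y.factorial * z.factorial := by positivity
  rw [h₃, Nat.factorial_succ (_ + _), ← h₂, Nat.factorial_succ, ← h₃] at h₁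
  exact Nat.eq_of_mul_eq_mul_right h₄ (by linarith)

theorem trinomial_right (x y z : ℕ) :
    trinomial x y (z + 1) * (z + 1) = (x + y + (z + 1)) * trinomial x y z := by
  have h₁ := trinomial_mul_factorial x y (z + 1)
  have h₂ := trinomial_mul_factorial x y z
  have h₃ : x + y + (z + 1) = x + y + z + 1 := by ring
  have h₄ : 0 < x.factorial * y.factorial * z.factorial := by positivity
  rw [h₃, Nat.factorial_succ (_ + _), ← h₂, Nat.factorial_succ, ← h₃] at h₁
  exact Nat.eq_of_mul_eq_mul_right h₄ (by linarith)

/-- The number of paths of height at most `t` that start at height `h` and have `f i` moves `H`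
and `u i` moves `U` of height `i`: at each height, the moves from there can be made in any order,
but the last one of them is a `D`. -/
def completions (t h : ℕ) (f u : ℕ → ℕ) : ℕ :=
  ∏ i ∈ Finset.range (t + 1), trinomial (u i - if i ≤ h then 0 else 1) (f i) (u (i + 1))

theorem completions_pos (t h : ℕ) (f u : ℕ → ℕ) : 0 < completions t h f u :=
  Finset.prod_pos fun _ _ => trinomial_pos _ _ _

/-- A move from height `h` only changes the factor that belongs to `h`. -/
theorem prod_mul_eq_mul_prod {s : Finset ℕ} {j p q : ℕ} (hj : j ∈ s) {g g' : ℕ → ℕ}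
    (h : ∀ i ∈ s, i ≠ j → g i = g' i) (hpq : g j * p = q * g' j) :
    (∏ i ∈ s, g i) * p = q * ∏ i ∈ s, g' i := by
  rw [← Finset.mul_prod_erase s g hj, ← Finset.mul_prod_erase s g' hj,
    Finset.prod_congr rfl (g := g') fun i hi => h i (Finset.mem_of_mem_erase hi)
      (Finset.ne_of_mem_erase hi), mul_right_comm, hpq, mul_assoc]

section completions

variable {t h : ℕ} {f u : ℕ → ℕ}

theorem completions_H (ht : h ≤ t) (hf : 0 < f h) :
    completions t h f u * f h =
      (u h + f h + u (h + 1)) * completions t h (Function.update f h (f h - 1)) u := by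
  refine prod_mul_eq_mul_prod (j := h) (Finset.mem_range.2 (by omega)) (fun i _ hi => ?_) ?_
  · simp [hi]
  · obtain ⟨y, hy⟩ := Nat.exists_eq_succ_of_ne_zero hf.ne'
    simp [hy, trinomial_mid]

theorem completions_U (ht : h ≤ t) (hu : 0 < u (h + 1)) :
    completions t h f u * u (h + 1) = (u h + f h + u (h + 1)) *
      completions t (h + 1) f (Function.update u (h + 1) (u (h + 1) - 1)) := by
  refine prod_mul_eq_mul_prod (j := h) (Finset.mem_range.2 (by omega)) (fun i _ hi => ?_) ?_
  · rw [Function.update_of_ne (by omega : i + 1 ≠ h + 1)]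
    rcases lt_trichotomy i (h + 1) with hlt | rfl | hgt
    · rw [Function.update_of_ne (by omega), if_pos (by omega), if_pos (by omega)]
    -- The factor at `h + 1` survives: the stock of ascents drops by one, but height `h + 1` no
    -- longer counts as lying above the path, so the subtracted `1` disappears.
    · rw [Function.update_self, if_neg (by omega), if_pos le_rfl, Nat.sub_zero]
    · rw [Function.update_of_ne (by omega), if_neg (by omega), if_neg (by omega)]
  · obtain ⟨y, hy⟩ := Nat.exists_eq_succ_of_ne_zero hu.ne'
    simp [hy, trinomial_right]

theorem completions_D (ht : h ≤ t) (hh : 0 < h) (hu : 0 < u h) :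
    completions t h f u * u h = (u h + f h + u (h + 1)) * completions t (h - 1) f u := by
  refine prod_mul_eq_mul_prod (j := h) (Finset.mem_range.2 (by omega)) (fun i _ hi => ?_) ?_
  · congr 2
    split_ifs <;> omega
  · rw [if_pos le_rfl, if_neg (by omega)]
    obtain ⟨y, hy⟩ := Nat.exists_eq_succ_of_ne_zero hu.ne'
    simp [hy, trinomial_left]

/-- Only the reserved last `D` is left at this height, so the move is forced and costs no factor.
Truncated subtraction gives `0 - 1 = 0`, leaving the product unchanged. -/
theorem completions_D_last (hu : u h = 0) : completions t h f u = completions t (h - 1) f u := by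
  refine Finset.prod_congr rfl fun i _ => ?_
  congr 1
  by_cases hi : i = h
  · rw [hi, hu]; simp
  · split_ifs <;> omega

end completions

theorem completions_eq_mult {n A : ℕ} {a : List ℕ} (ha : a ∈ S n A) :
    completions (top a) 0 (flats a) (peaks a) = mult a := by
  simp only [completions, mult, trinomial, Finset.prod_mul_distrib]
  congr 1
  · rw [prod_Icc_eq_prod_range (fun i => (peaks a (i + 1) + flats a i + peaks a i - 1).choose
      (peaks a i - 1)) (by simp [peaks_zero])]
    refine Finset.prod_congr rfl fun i hi => ?_
    by_cases h0 : i = 0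
    · simp [h0, peaks_zero]
    · have := (peaks_pos_iff ha (i := i)).2 ⟨by omega, by have := Finset.mem_range.1 hi; omega⟩
      rw [if_neg (by omega)]
      congr 1
      omega
  -- The second binomials match after an index shift by one; the surplus one at the top is `1`,
  -- since nothing rises from there.
  · rw [Finset.prod_range_succ, peaks_eq_zero ha (Nat.lt_succ_self _), add_zero,
      Nat.choose_self, mul_one, Finset.range_eq_Ico]
    refine (Finset.prod_Ico_add' (fun i => (flats a (i - 1) + peaks a i).choose
      (flats a (i - 1))) 0 (top a) 1).trans (Finset.prod_congr rfl fun i _ => by rw [add_comm])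

/-! ### Sampling paths -/

/-- The remaining number of moves `H` at the current height, which is half of `x₁`. -/
def flatExpr : Expr := .get 1 (.add (.var 1) (.const 1))

/-- The remaining number of moves `U` from the current height. -/
def upExpr : Expr := .get 1 (.add (.var 1) (.const 2))

/-- The remaining number of moves `U` to the current height. -/
def downExpr : Expr := .get 1 (.var 1)

/-- Appends a move to the path: a random one of the moves that remain to be made from the current
height, apart from the last `D`. -/
def pathBody : Prog :=
  .seq (.rand 2 (.sub (.add (.add flatExpr upExpr) downExpr) (.const 1))) <|
  .seq (.cond (.sub flatExpr (.var 2))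
    (.seq (.put 0 (.var 0) (.const 1))
      (.put 1 (.add (.var 1) (.const 1)) (.sub flatExpr (.const 1))))
    (.cond (.sub (.add flatExpr upExpr) (.var 2))
      (.seq (.put 0 (.var 0) (.const 2)) <|
        .seq (.put 1 (.add (.var 1) (.const 2)) (.sub upExpr (.const 1)))
          (.set 1 (.add (.var 1) (.const 2))))
      (.seq (.put 0 (.var 0) (.const 0)) (.set 1 (.sub (.var 1) (.const 2))))))
    (.set 0 (.add (.var 0) (.const 1)))

/-- Appends moves to the path until it is complete. -/
def pathLoop : Prog :=
  .loop (.add (.add (.var 1) (.get 1 (.const 1))) (.get 1 (.const 2))) pathBody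

/-- Copies the input, shifted by one, to the array `a₁`. -/
def shiftLoop : Prog :=
  .loop (.var 1) <| .seq (.put 1 (.var 1) (.get 0 (.sub (.var 1) (.const 1))))
    (.set 1 (.sub (.var 1) (.const 1)))

/-- The program that samples the paths that can be built from a given sequence. -/
def pathProg : Prog :=
  .seq (.set 1 (.var 0)) <| .seq shiftLoop <| .seq (.put 1 (.const 0) (.const 0)) <|
  .seq (.put 1 (.add (.var 0) (.const 1)) (.const 0)) <| .seq (.set 0 (.const 0)) pathLoop

/-- The memory while a path is sampled: the current height is `h`, and `f i` moves `H` and `u i`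
moves `U` of height `i` remain to be made. -/
structure PathState (t : ℕ) (s : Store) (h : ℕ) (f u : ℕ → ℕ) : Prop where
  var_one : s.var 1 = 2 * h
  arr_odd : ∀ i ≤ t, s.arr 1 (2 * i + 1) = f i
  arr_even : ∀ i ≤ t + 1, s.arr 1 (2 * i) = u i
  le : h ≤ t
  up_zero : u 0 = 0
  flat_eq_zero : ∀ i, t < i → f i = 0
  up_eq_zero : ∀ i, t < i → u i = 0
  flat_above : ∀ i, h < i → u i = 0 → f i = 0
  up_above : ∀ i, h < i → u i = 0 → u (i + 1) = 0

theorem sum_update_pred {K j : ℕ} {g : ℕ → ℕ} (hj : j < K) (hg : 0 < g j) :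
    ∑ i ∈ Finset.range K, Function.update g j (g j - 1) i + 1 = ∑ i ∈ Finset.range K, g i := by
  have hj' := Finset.mem_range.2 hj
  rw [Finset.sum_update_of_mem hj', ← Finset.add_sum_erase _ g hj', Finset.sdiff_singleton_eq_erase]
  omega

theorem Samples.congr {c : Config} {T : ℕ} {X X' : Set (List ℕ)} {W W' : ℕ}
    (h : Samples c T X W) (hX : X = X') (hW : W = W') : Samples c T X' W' := hX ▸ hW ▸ h

/-- The loop test only looks at the height and at the moves available at height `0`. When these are
exhausted nothing remains higher up either, because without an ascent to a height above the current
one no later move there is in stock. -/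
theorem samples_pathLoop_of_done {t : ℕ} {s : Store} {f u : ℕ → ℕ} (hs : PathState t s 0 f u)
    (hf : f 0 = 0) (hu : u 1 = 0) (T : ℕ) :
    Samples ([pathLoop], s) (T + 1) {l | ∃ mz, Completes 0 f u mz ∧ l = s.output ++ pathCode mz}
      (completions t 0 f u) := by
  have hu' : ∀ i, u i = 0 := by
    intro i
    induction i with
    | zero => exact hs.up_zero
    | succ i ih =>
      rcases Nat.eq_zero_or_pos i with rfl | hi
      · exact hu
      · exact hs.up_above i hi ih
  have hf' : ∀ i, f i = 0 := by
    intro i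
    rcases Nat.eq_zero_or_pos i with rfl | hi
    · exact hf
    · exact hs.flat_above i hi (hu' i)
  have h₁ := hs.var_one
  have h₂ := hs.arr_odd 0 (by omega)
  have h₃ := hs.arr_even 1 (by omega)
  refine Samples.loop_zero (by simp_all [Expr.val]) ((samples_nil s T).congr ?_ ?_)
  · ext l
    simp only [Set.mem_singleton_iff, Set.mem_ofPred_eq]
    constructor
    · rintro rfl
      exact ⟨[], completes_nil.2 ⟨rfl, hf', hu'⟩, by simp [pathCode]⟩
    · rintro ⟨mz, hmz, rfl⟩
      cases mz with
      | nil => simp [pathCode]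
      | cons m mz =>
        cases m with
        | U => have := (completes_U.1 hmz).1; simp [hu'] at this
        | H => have := (completes_H.1 hmz).1; simp [hf'] at this
        | D => have := (completes_D.1 hmz).1; omega
  · simp [completions, hf', hu', trinomial]

/-! ### The effect of a single move on the remaining stock. -/

section steps

variable {t h : ℕ} {s s' : Store} {f u : ℕ → ℕ}

theorem PathState.step_H (hs : PathState t s h f u) (hf : 0 < f h) (h₁ : s'.var 1 = s.var 1)
    (h₂ : ∀ j, s'.arr 1 j = if j = 2 * h + 1 then f h - 1 else s.arr 1 j) :
    PathState t s' h (Function.update f h (f h - 1)) u where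
  var_one := by rw [h₁, hs.var_one]
  arr_odd i hi := by
    rw [h₂, Function.update_apply]
    split_ifs <;> first | rfl | omega | exact hs.arr_odd i hi
  arr_even i hi := by rw [h₂, if_neg (by omega), hs.arr_even i hi]
  le := hs.le
  up_zero := hs.up_zero
  flat_eq_zero i hi := by
    have := hs.le
    rw [Function.update_of_ne (by omega), hs.flat_eq_zero i hi]
  up_eq_zero := hs.up_eq_zero
  flat_above i hi hu := by rw [Function.update_of_ne (by omega), hs.flat_above i hi hu]
  up_above := hs.up_above

theorem PathState.step_U (hs : PathState t s h f u) (hu : 0 < u (h + 1))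
    (h₁ : s'.var 1 = s.var 1 + 2)
    (h₂ : ∀ j, s'.arr 1 j = if j = 2 * h + 2 then u (h + 1) - 1 else s.arr 1 j) :
    PathState t s' (h + 1) f (Function.update u (h + 1) (u (h + 1) - 1)) where
  var_one := by rw [h₁, hs.var_one]; ring
  arr_odd i hi := by rw [h₂, if_neg (by omega), hs.arr_odd i hi]
  arr_even i hi := by
    rw [h₂, Function.update_apply]
    split_ifs <;> first | rfl | omega | exact hs.arr_even i hi
  le := by
    by_contra hc
    rw [hs.up_eq_zero _ (by omega)] at hu
    omega
  up_zero := by rw [Function.update_of_ne (by omega), hs.up_zero]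
  flat_eq_zero := hs.flat_eq_zero
  up_eq_zero i hi := by
    rw [Function.update_apply, hs.up_eq_zero i hi]
    split_ifs with hc
    · rw [← hc, hs.up_eq_zero i hi]
    · rfl
  flat_above i hi hi' := by
    rw [Function.update_of_ne (by omega)] at hi'
    exact hs.flat_above i (by omega) hi'
  up_above i hi hi' := by
    rw [Function.update_of_ne (by omega)] at hi' ⊢
    exact hs.up_above i (by omega) hi'

theorem PathState.step_D (hs : PathState t s h f u) (hh : 0 < h)
    (hu : u h = 0 → f h = 0 ∧ u (h + 1) = 0) (h₁ : s'.var 1 = s.var 1 - 2)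
    (h₂ : ∀ j, s'.arr 1 j = s.arr 1 j) : PathState t s' (h - 1) f u where
  var_one := by rw [h₁, hs.var_one]; omega
  arr_odd i hi := by rw [h₂, hs.arr_odd i hi]
  arr_even i hi := by rw [h₂, hs.arr_even i hi]
  le := by have := hs.le; omega
  up_zero := hs.up_zero
  flat_eq_zero := hs.flat_eq_zero
  up_eq_zero := hs.up_eq_zero
  flat_above i hi hi' := by
    rcases eq_or_ne i h with rfl | hne
    · exact (hu hi').1
    · exact hs.flat_above i (by omega) hi'
  up_above i hi hi' := by
    rcases eq_or_ne i h with rfl | hne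
    · exact (hu hi').2
    · exact hs.up_above i (by omega) hi'

end steps

/-- Induction on a bound `N` for the number of remaining moves, which is the sum in `hN`. The random
number picks one of the free moves at height `h`, and the ratios `completions_H`, `completions_U`
and `completions_D` are exactly what `Samples.rand` asks for. -/
theorem samples_pathLoop {t N : ℕ} {s : Store} {h : ℕ} {f u : ℕ → ℕ}
    (hs : PathState t s h f u)
    (hN : ∑ i ∈ Finset.range (t + 1), f i + 2 * ∑ i ∈ Finset.range (t + 1), u i + h ≤ N) :
    Samples ([pathLoop], s) (12 * N + 1)
      {l | ∃ mz, Completes h f u mz ∧ l = s.output ++ pathCode mz} (completions t h f u) := by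
  induction N generalizing s h f u with
  | zero =>
    obtain rfl : h = 0 := by omega
    have hf : ∑ i ∈ Finset.range (t + 1), f i = 0 := by omega
    have hu : ∑ i ∈ Finset.range (t + 1), u i = 0 := by omega
    rw [Finset.sum_eq_zero_iff] at hf hu
    refine samples_pathLoop_of_done hs (hf 0 (by simp)) ?_ 0
    rcases Nat.eq_zero_or_pos t with rfl | ht
    · exact hs.up_eq_zero 1 (by omega)
    · exact hu 1 (by simpa using ht)
  | succ N ih =>
    have hle := hs.le
    have hv := hs.var_one
    have hf₁ : s.arr 1 (2 * h + 1) = f h := hs.arr_odd h hle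
    have hu₁ : s.arr 1 (2 * h + 2) = u (h + 1) := hs.arr_even (h + 1) (by omega)
    have hu₂ : s.arr 1 (2 * h) = u h := hs.arr_even h (by omega)
    have hf₀ := hs.arr_odd 0 (by omega)
    have hu₀ := hs.arr_even 1 (by omega)
    by_cases hdone : h = 0 ∧ f 0 = 0 ∧ u 1 = 0
    · obtain ⟨rfl, hf, hu⟩ := hdone
      exact samples_pathLoop_of_done hs hf hu _
    have hloop : Expr.val s (.add (.add (.var 1) (.get 1 (.const 1))) (.get 1 (.const 2))) ≠ 0 := by
      simp only [Expr.val, hv]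
      simp only [mul_zero, zero_add, mul_one] at hf₀ hu₀
      rw [hf₀, hu₀]
      omega
    have hh : h = 0 → u h = 0 := fun h0 => h0 ▸ hs.up_zero
    have hdone' : h = 0 → ¬(f h = 0 ∧ u (h + 1) = 0) := by
      rintro rfl
      simpa using hdone
    -- There are `u h + f h + u (h + 1)` free moves. If there are none, `M` is still `1`: the draw
    -- is trivial and produces the forced last `D`.
    set M := u h + f h + u (h + 1) - 1 + 1 with hM
    set Y : Move → Set (List ℕ) := fun m =>
      {l | ∃ mz, Completes h f u (m :: mz) ∧ l = s.output ++ pathCode (m :: mz)} with hY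
    set V : Move → ℕ := fun m => match m with
      | .H => completions t h (Function.update f h (f h - 1)) u
      | .U => completions t (h + 1) f (Function.update u (h + 1) (u (h + 1) - 1))
      | .D => completions t (h - 1) f u with hV
    set move : ℕ → Move := fun r =>
      if r < f h then .H else if r < f h + u (h + 1) then .U else .D with hmove
    have hfsum : 0 < f h → _ := sum_update_pred (K := t + 1) (g := f) (Nat.lt_succ_of_le hle)
    -- One round takes at most `12` steps; the branch `U` needs all of them.
    refine Samples.mono (T := 12 * N + 1 + 12) ?_ (by omega)
    refine .loop_pos hloop (.seq ((.rand (N := M) ?_ (Y := fun r => Y (move r))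
      (V := fun r => V (move r)) ?_ ?_ ?_)))
    · simp only [Expr.val, flatExpr, upExpr, downExpr, hv, hf₁, hu₁, hu₂, hM]
      omega
    · intro r hr
      refine .seq ?_
      by_cases h₁ : r < f h
      · have hm : move r = .H := if_pos h₁
        have hf : 0 < f h := by omega
        refine .cond_pos (by simp [Expr.val, flatExpr, hv, hf₁]; omega) (.seq (.put (.put (.set ?_))))
        refine Samples.mono (T := 12 * N + 1) ?_ (by omega)
        refine (ih (f := Function.update f h (f h - 1)) (hs.step_H hf ?_ ?_) ?_).congr ?_ (by rw [hm])
        · simp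
        · intro j
          simp [Expr.val, flatExpr, hv, hf₁]
        · have := hfsum hf
          omega
        · rw [hm, Store.output_snoc (s := s) (c := 1)]
          · ext l
            simp [hY, completes_H, hf, pathCode, Move.code]
          · simp [Expr.val]
          · intro j hj
            simp [Expr.val]
            omega
          · simp [Expr.val]
      by_cases h₂ : r < f h + u (h + 1)
      · have hm : move r = .U := by simp [hmove, h₁, h₂]
        have hu : 0 < u (h + 1) := by omega
        refine .cond_zero (by simp [Expr.val, flatExpr, hv, hf₁]; omega)
          (.cond_pos (by simp [Expr.val, flatExpr, upExpr, hv, hf₁, hu₁]; omega)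
            (.seq (.put (.seq (.put (.set (.set ?_)))))))
        refine Samples.mono (T := 12 * N + 1) ?_ (by omega)
        -- This state is used only for its consequence `h + 1 ≤ t`, which puts the updated index
        -- inside the range of the sum.
        have hst := hs.step_U (s' := (((((s.setVar 2 r).setArr 0 (s.var 0) 2).setArr 1 (2 * h + 2)
          (u (h + 1) - 1)).setVar 1 (2 * h + 2)).setVar 0 (s.var 0 + 1))) hu
          (by simp [hv]) (fun j => by simp)
        have := sum_update_pred (K := t + 1) (g := u) (Nat.lt_succ_of_le hst.le) hu
        refine Samples.congr (X := {l | ∃ mz, Completes (h + 1) f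
          (Function.update u (h + 1) (u (h + 1) - 1)) mz ∧ l = _ ++ pathCode mz})
          (W := completions t (h + 1) f (Function.update u (h + 1) (u (h + 1) - 1)))
          (ih (hs.step_U hu ?_ ?_) (by omega)) ?_ (by rw [hm])
        · simp [Expr.val]
        · intro j
          simp [Expr.val, upExpr, hv, hu₁]
        · rw [hm, Store.output_snoc (s := s) (c := 2)]
          · ext l
            simp [hY, completes_U, hu, pathCode, Move.code]
          · simp [Expr.val]
          · intro j hj
            simp [Expr.val]
            omega
          · simp [Expr.val]
      · have hm : move r = .D := by simp [hmove, h₁, h₂]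
        have hpos : 0 < h := by
          by_contra h0
          have := hh (by omega)
          have := hdone' (by omega)
          omega
        refine .cond_zero (by simp [Expr.val, flatExpr, hv, hf₁]; omega)
          (.cond_zero (by simp [Expr.val, flatExpr, upExpr, hv, hf₁, hu₁]; omega)
            (.seq (.put (.set (.set ?_)))))
        refine Samples.mono (T := 12 * N + 1) ?_ (by omega)
        refine Samples.congr (ih (hs.step_D hpos (by omega) ?_ ?_) (by omega)) ?_ (by rw [hm])
        · simp [Expr.val]
        · intro j
          simp [Expr.val]
        · rw [hm, Store.output_snoc (s := s) (c := 0)]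
          · ext l
            simp [hY, completes_D, hpos, pathCode, Move.code]
          · simp [Expr.val]
          · intro j hj
            simp [Expr.val]
            omega
          · simp [Expr.val]
    · rintro r - l ⟨mz, hmz, rfl⟩
      exact ⟨_, hmz, rfl⟩
    · rintro l ⟨mz, hmz, rfl⟩
      have hmem : ∀ m mz', mz = m :: mz' → ∀ r, s.output ++ pathCode mz ∈ Y (move r) ↔
          move r = m := by
        rintro m mz' rfl r
        constructor
        · rintro ⟨mz'', -, heq⟩
          have := pathCode_injective (List.append_cancel_left heq)
          exact (List.cons.inj this).1.symm
        · rintro rfl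
          exact ⟨mz', hmz, rfl⟩
      have hVpos : ∀ m, 0 < V m := by
        intro m
        cases m <;> exact completions_pos _ _ _ _
      have hmH : ∀ r, move r = .H ↔ r < f h := by
        intro r
        simp only [hmove]
        split_ifs <;> simp_all
      have hmU : ∀ r, move r = .U ↔ f h ≤ r ∧ r < f h + u (h + 1) := by
        intro r
        simp only [hmove]
        split_ifs <;> simp_all
      have hmD : ∀ r, move r = .D ↔ f h + u (h + 1) ≤ r := by
        intro r
        simp only [hmove]
        split_ifs <;> simp_all <;> omega
      cases mz with
      | nil =>
        obtain ⟨h0, hf, hu⟩ := completes_nil.1 hmz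
        exact absurd ⟨h0, hf 0, hu 1⟩ hdone
      | cons m mz =>
        obtain ⟨R, hR, hc⟩ : ∃ R : Finset ℕ, (∀ r, r ∈ R ↔ r < M ∧ move r = m) ∧
            R.card * completions t h f u = M * V m := by
          cases m with
          | H =>
            have hf := (completes_H.1 hmz).1
            refine ⟨Finset.range (f h), fun r => ?_, ?_⟩
            · rw [hmH, Finset.mem_range]
              omega
            · rw [Finset.card_range, mul_comm, completions_H hle hf]
              congr 1
              omega
          | U =>
            have hu := (completes_U.1 hmz).1
            refine ⟨Finset.Ico (f h) (f h + u (h + 1)), fun r => ?_, ?_⟩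
            · rw [hmU, Finset.mem_Ico]
              omega
            · rw [Nat.card_Ico, Nat.add_sub_cancel_left, mul_comm, completions_U hle hu]
              congr 1
              omega
          | D =>
            obtain ⟨hpos, hc⟩ := completes_D.1 hmz
            refine ⟨Finset.Ico (f h + u (h + 1)) M, fun r => ?_, ?_⟩
            · rw [hmD, Finset.mem_Ico, and_comm]
            rw [Nat.card_Ico]
            rcases Nat.eq_zero_or_pos (u h) with hu | hu
            -- The completion after this `D` starts below `h` and has no ascent to `h`, so it has no
            -- moves left at `h` at all. Hence `M = 1` and the draw has a single value.
            · have h0 := countFrom_eq_zero hc.1 (i := h) (by omega) (by rw [hc.2.2, hu])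
              rw [hc.2.1, hc.2.2] at h0
              rw [completions_D_last hu]
              congr 1
              omega
            · rw [show M - (f h + u (h + 1)) = u h by omega, mul_comm, completions_D hle hpos hu]
              congr 1
              omega
        refine ⟨R, V m, fun r => ?_, fun r hr => ?_, hc, hVpos m⟩
        · rw [hR, hmem m mz rfl]
        · simp only [((hR r).1 hr).2]

theorem samples_shiftLoop {k : List Prog} {T : ℕ} {X : Set (List ℕ)} {W m : ℕ} {s : Store}
    (hm : s.var 1 = m)
    (h : ∀ s' : Store, s'.var 0 = s.var 0 → s'.var 1 = 0 →
      (∀ j, s'.arr 1 j = if 1 ≤ j ∧ j ≤ m then s.arr 0 (j - 1) else s.arr 1 j) →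
      Samples (k, s') T X W) :
    Samples (shiftLoop :: k, s) (T + 4 * m + 1) X W := by
  induction m generalizing s with
  | zero =>
    refine Samples.loop_zero hm (h s rfl hm fun j => ?_)
    rw [if_neg (by omega)]
  | succ m ih =>
    refine Samples.mono (T := T + 4 * m + 1 + 4) ?_ (by omega)
    refine Samples.loop_pos (by simp [Expr.val, hm]) (.seq (.put (.set
      (ih ?_ fun s' h₁ h₂ h₃ => h s' ?_ h₂ fun j => ?_))))
    · simp [Expr.val, hm]
    · simpa using h₁
    · rw [h₃]
      simp only [Expr.val, Store.setVar_arr, Store.setArr_arr, hm]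
      simp only [zero_ne_one, false_and, if_false, true_and]
      split_ifs <;> first | rfl | omega | (congr 1; omega)

/-- Each level up to the top has a peak, which has width two. This keeps the time for copying the
sequence linear in `n`. -/
theorem top_le {n A : ℕ} {a : List ℕ} (ha : a ∈ S n A) : 2 * top a ≤ n := by
  have := Finset.card_nsmul_le_sum (Finset.Icc 1 (top a)) (fun i => peaks a i) 1 ha.2.1
  rw [Nat.card_Icc, smul_eq_mul, mul_one, Nat.add_sub_cancel] at this
  have := ha.2.2.1
  omega

theorem samples_pathProg {n A : ℕ} {a : List ℕ} (ha : a ∈ S n A) {s : Store}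
    (hs : s.output = a) :
    Samples ([pathProg], s) (16 * n + 20) (pathCode '' {mz ∈ MZ n A | BuiltFrom a mz})
      (mult a) := by
  obtain ⟨hs₀, hs₁⟩ := Store.output_eq_iff.1 hs
  have hlen := ha.1
  have htop := top_le ha
  refine Samples.mono (T := (12 * n + 1 + 6) + 4 * (2 * top a + 1) + 1 + 3) ?_ (by omega)
  refine .seq (.set (.seq (samples_shiftLoop (by simp [Expr.val, hs₀, hlen])
    fun s' h₁ h₂ h₃ => .seq (.put (.seq (.put (.seq (.set ?_))))))))
  simp only [Store.setVar_arr, Store.setVar_var, Expr.val] at h₁ h₃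
  rw [if_neg (by omega)] at h₁
  refine (samples_pathLoop (t := top a) (h := 0) (f := flats a) (u := peaks a) ?_ ?_).congr ?_
    (completions_eq_mult ha)
  · constructor
    · simp [h₂]
    · intro i hi
      simp only [Store.setVar_arr, Store.setArr_arr, Expr.val, Store.setArr_var, h₁, hs₀, h₃]
      rw [if_neg (by omega), if_neg (by omega), if_pos (by omega), hs₁ _ (by omega)]
      rfl
    · intro i hi
      simp only [Store.setVar_arr, Store.setArr_arr, Expr.val, Store.setArr_var, h₁, hs₀, h₃,
        true_and]
      -- The positions `2 * top a + 2` and `0` stand for the ascents to `top a + 1` and to `0`. They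
      -- were cleared explicitly, since the initial memory may hold anything there.
      split_ifs with h₄ h₅ h₆
      · exact (peaks_eq_zero ha (by omega)).symm
      · rw [show i = 0 by omega, peaks_zero]
      · rw [peaks, if_neg (by omega), hs₁ _ (by omega)]
      · omega
    · omega
    · exact peaks_zero a
    · exact fun i => flats_eq_zero ha
    · exact fun i => peaks_eq_zero ha
    · intro i hi hp
      by_contra hf
      have : ¬ top a < i := fun h' => hf (flats_eq_zero ha h')
      have := (peaks_pos_iff ha (i := i)).2 ⟨hi, by omega⟩
      omega
    · intro i hi hp
      by_contra hf
      have := (peaks_pos_iff ha).1 (Nat.pos_of_ne_zero hf)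
      have := (peaks_pos_iff ha (i := i)).2 ⟨hi, by omega⟩
      omega
  · have := ha.2.2.1
    rw [sum_Icc_eq_sum_range _ (peaks_zero a)] at this
    omega
  · ext l
    simp only [Set.mem_ofPred_eq, Set.mem_image, mem_MZ_and_builtFrom_iff ha]
    refine exists_congr fun mz => and_congr_right fun _ => ?_
    simp [Store.output, Expr.val, eq_comm]

/-! ### Partial labelings of a path -/

/-- The move of the path of a permutation of the natural numbers at `i`. -/
def moveAt (π : Equiv.Perm ℕ) (i : ℕ) : Move :=
  if i < π i ∧ i < π⁻¹ i then .U else if π i < i ∧ π⁻¹ i < i then .D else .H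

theorem moveAt_eq_U {π : Equiv.Perm ℕ} {i : ℕ} : moveAt π i = .U ↔ i < π i ∧ i < π⁻¹ i := by
  rw [moveAt]
  split_ifs <;> simp_all

theorem moveAt_eq_D {π : Equiv.Perm ℕ} {i : ℕ} : moveAt π i = .D ↔ π i < i ∧ π⁻¹ i < i := by
  rw [moveAt]
  split_ifs <;> simp_all
  omega

theorem moveAt_eq_H {π : Equiv.Perm ℕ} {i : ℕ} :
    moveAt π i = .H ↔ ¬(i < π i ∧ i < π⁻¹ i) ∧ ¬(π i < i ∧ π⁻¹ i < i) := by
  rw [moveAt]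
  split_ifs <;> simp_all

/-- Suppose that the first `k` elements are labelled by `ρ`, and that their images and preimages
from `k` on are still unknown: the images of the elements of `O`, and the preimages of the elements
of `ρ '' O`. Then `π` is a permutation which extends this labelling, and whose path continues
as `mz` does. -/
def Extends (mz : List Move) (k : ℕ) (O : Set ℕ) (ρ π : Equiv.Perm ℕ) : Prop :=
  (∀ i < k, i ∉ O → π i = ρ i) ∧ (∀ i ∈ O, k ≤ π i) ∧
    ∀ i, k ≤ i → i < mz.length → mz[i]? = some (moveAt π i)

section extensions

variable {mz : List Move} {k s t : ℕ} {O : Set ℕ} {ρ π : Equiv.Perm ℕ}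

theorem apply_lt (hρ : ∀ i, k ≤ i → ρ i = i) {i : ℕ} (hi : i < k) : ρ i < k := by
  by_contra hc
  have := ρ.injective (hρ (ρ i) (not_lt.1 hc))
  omega

/-- If the position holding this value under `ρ` were not open, `π` would take the value twice. Thus
the free values are the placeholders that `ρ` keeps at the open positions. -/
theorem Extends.exists_value (h : Extends mz k O ρ π) (hρ : ∀ i, k ≤ i → ρ i = i)
    (hk : π k < k) : ∃ s ∈ O, π k = ρ s := by
  obtain ⟨s, hs⟩ := ρ.surjective (π k)
  refine ⟨s, ?_, hs.symm⟩
  by_contra hO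
  by_cases hlt : s < k
  · have := π.injective ((h.1 s hlt hO).trans hs)
    omega
  · have := hρ s (not_lt.1 hlt)
    omega

theorem Extends.mem_of_apply_eq (h : Extends mz k O ρ π) (hρ : ∀ i, k ≤ i → ρ i = i)
    (hs : s < k) (hk : π s = k) : s ∈ O := by
  by_contra hO
  have h₁ := h.1 s hs hO
  have h₂ := hρ k le_rfl
  have := ρ.injective ((h₁.symm.trans hk).trans h₂.symm)
  omega

/-- The common frame of the five cases below: `C` is the decision taken at `k`, and the conditions
on the moves after `k` are the same on both sides. -/
theorem extends_succ_iff {C : Prop} {O' : Set ℕ} {ρ' : Equiv.Perm ℕ} {m : Move}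
    (hlen : k < mz.length) (hm : mz[k]? = some m)
    (h₁ : (∀ i < k + 1, i ∉ O' → π i = ρ' i) → (∀ i ∈ O', k + 1 ≤ π i) →
      moveAt π k = m ∧ (∀ i < k, i ∉ O → π i = ρ i) ∧ (∀ i ∈ O, k ≤ π i) ∧ C)
    (h₂ : moveAt π k = m → (∀ i < k, i ∉ O → π i = ρ i) → (∀ i ∈ O, k ≤ π i) → C →
      (∀ i < k + 1, i ∉ O' → π i = ρ' i) ∧ (∀ i ∈ O', k + 1 ≤ π i)) :
    Extends mz (k + 1) O' ρ' π ↔ Extends mz k O ρ π ∧ C := by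
  constructor
  · rintro ⟨ha, hb, hc⟩
    obtain ⟨h₃, h₄, h₅, h₆⟩ := h₁ ha hb
    refine ⟨⟨h₄, h₅, fun i hi hi' => ?_⟩, h₆⟩
    rcases eq_or_lt_of_le hi with rfl | hlt
    · rw [hm, h₃]
    · exact hc i hlt hi'
  · rintro ⟨⟨ha, hb, hc⟩, hC⟩
    have := hc k le_rfl hlen
    rw [hm, Option.some.injEq] at this
    obtain ⟨h₃, h₄⟩ := h₂ this.symm ha hb hC
    exact ⟨h₃, h₄, fun i hi hi' => hc i (by omega) hi'⟩

theorem extends_U (hlen : k < mz.length) (hO : ∀ i ∈ O, i < k)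
    (hρ : ∀ i, k ≤ i → ρ i = i) (hm : mz[k]? = some .U) :
    Extends mz (k + 1) (insert k O) ρ π ↔ Extends mz k O ρ π := by
  rw [extends_succ_iff (C := True) hlen hm, and_true]
  · intro ha hb
    refine ⟨moveAt_eq_U.2 ⟨hb k (by simp), ?_⟩, fun i hi hiO => ha i (by omega) ?_,
      fun i hi => ?_, trivial⟩
    · obtain ⟨x, hx⟩ := π.surjective k
      rw [Equiv.Perm.inv_eq_iff_eq.2 hx.symm]
      by_contra hle
      by_cases hxO : x ∈ insert k O
      · have := hb x hxO
        omega
      · have hne : x ≠ k := fun h => hxO (h ▸ Set.mem_insert _ _)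
        have h₁ := ha x (by omega) hxO
        have h₂ := hρ k le_rfl
        exact hne (ρ.injective ((h₁.symm.trans hx).trans h₂.symm))
    · rintro (rfl | h)
      · omega
      · exact hiO h
    · have := hb i (Set.mem_insert_of_mem _ hi)
      omega
  · intro hmk ha hb _
    obtain ⟨h₁, h₂⟩ := moveAt_eq_U.1 hmk
    refine ⟨fun i hi hiO => ?_, ?_⟩
    · rw [Set.mem_insert_iff, not_or] at hiO
      exact ha i (by omega) hiO.2
    · rintro i (rfl | hi)
      · exact h₁
      · refine lt_of_le_of_ne (hb i hi) fun h => ?_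
        rw [Equiv.Perm.inv_eq_iff_eq.2 h] at h₂
        have := hO i hi
        omega

theorem extends_fixed (hlen : k < mz.length) (hO : ∀ i ∈ O, i < k)
    (hρ : ∀ i, k ≤ i → ρ i = i) (hm : mz[k]? = some .H) :
    Extends mz (k + 1) O ρ π ↔ Extends mz k O ρ π ∧ π k = k := by
  apply extends_succ_iff hlen hm
  · intro ha hb
    have hk : π k = k := (ha k (by omega) fun h => (hO k h).false).trans (hρ k le_rfl)
    refine ⟨moveAt_eq_H.2 ⟨by omega, by omega⟩, fun i hi hiO => ha i (by omega) hiO,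
      fun i hi => ?_, hk⟩
    have := hb i hi
    omega
  · intro hmk ha hb hk
    refine ⟨fun i hi hiO => ?_, fun i hi => ?_⟩
    · rcases Nat.lt_succ_iff_lt_or_eq.1 hi with h | rfl
      · exact ha i h hiO
      · rw [hk, hρ i le_rfl]
    · refine lt_of_le_of_ne (hb i hi) fun h => ?_
      have := π.injective (hk.trans h)
      have := hO i hi
      omega

/-- Position `k` takes the value stored at the open position `s`. The swap leaves `k` at `s` as the
new placeholder, so the open positions stay the same while the free value `ρ s` is replaced by `k`.
-/
theorem extends_value (hlen : k < mz.length) (hO : ∀ i ∈ O, i < k)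
    (hρ : ∀ i, k ≤ i → ρ i = i) (hm : mz[k]? = some .H) (hs : s ∈ O) :
    Extends mz (k + 1) O (ρ * Equiv.swap k s) π ↔ Extends mz k O ρ π ∧ π k = ρ s := by
  have hsk := hO s hs
  have hρs := apply_lt hρ hsk
  apply extends_succ_iff hlen hm
  · intro ha hb
    have hk : π k = ρ s := by
      rw [ha k (by omega) fun h => (hO k h).false, Equiv.Perm.mul_apply, Equiv.swap_apply_left]
    have hlt : ∀ i < k, i ∉ O → π i = ρ i := by
      intro i hi hiO
      have : i ≠ s := fun h => hiO (h ▸ hs)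
      rw [ha i (by omega) hiO, Equiv.Perm.mul_apply, Equiv.swap_apply_of_ne_of_ne (by omega) this]
    refine ⟨moveAt_eq_H.2 ⟨by omega, fun h => ?_⟩, hlt, fun i hi => ?_, hk⟩
    · obtain ⟨x, hx⟩ := π.surjective k
      rw [Equiv.Perm.inv_eq_iff_eq.2 hx.symm] at h
      by_cases hxO : x ∈ O
      · have := hb x hxO
        omega
      · have h₁ := hlt x h.2 hxO
        have h₂ := hρ k le_rfl
        have := ρ.injective ((h₁.symm.trans hx).trans h₂.symm)
        omega
    · have := hb i hi
      omega
  · intro hmk ha hb hk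
    refine ⟨fun i hi hiO => ?_, fun i hi => ?_⟩
    · have : i ≠ s := fun h => hiO (h ▸ hs)
      rcases Nat.lt_succ_iff_lt_or_eq.1 hi with h | rfl
      · rw [ha i h hiO, Equiv.Perm.mul_apply, Equiv.swap_apply_of_ne_of_ne (by omega) this]
      · rw [hk, Equiv.Perm.mul_apply, Equiv.swap_apply_left]
    · refine lt_of_le_of_ne (hb i hi) fun h => (moveAt_eq_H.1 hmk).2 ⟨by omega, ?_⟩
      rw [Equiv.Perm.inv_eq_iff_eq.2 h]
      exact hO i hi

/-- The same swap as for a chosen value, read the other way: `s` is now settled with image `k`, and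
`k` becomes open with the old value of `s` as its placeholder. -/
theorem extends_source (hlen : k < mz.length) (hO : ∀ i ∈ O, i < k)
    (hρ : ∀ i, k ≤ i → ρ i = i) (hm : mz[k]? = some .H) (hs : s ∈ O) :
    Extends mz (k + 1) (insert k (O \ {s})) (ρ * Equiv.swap k s) π ↔
      Extends mz k O ρ π ∧ π s = k := by
  have hsk := hO s hs
  apply extends_succ_iff hlen hm
  · intro ha hb
    have hk : π s = k := by
      rw [ha s (by omega) (by simp; omega), Equiv.Perm.mul_apply, Equiv.swap_apply_right,
        hρ k le_rfl]
    refine ⟨moveAt_eq_H.2 ⟨?_, ?_⟩, fun i hi hiO => ?_, fun i hi => ?_, hk⟩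
    · rw [Equiv.Perm.inv_eq_iff_eq.2 hk.symm]
      omega
    · have := hb k (by simp)
      omega
    · have : i ≠ s := fun h => hiO (h ▸ hs)
      rw [ha i (by omega) (by simp [hiO]; omega), Equiv.Perm.mul_apply,
        Equiv.swap_apply_of_ne_of_ne (by omega) this]
    · by_cases his : i = s
      · rw [his, hk]
      · have := hb i (by simp [hi, his])
        omega
  · intro hmk ha hb hk
    have hinv := Equiv.Perm.inv_eq_iff_eq.2 hk.symm
    refine ⟨fun i hi hiO => ?_, ?_⟩
    · have hik : i ≠ k := fun h => hiO (h ▸ Set.mem_insert _ _)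
      by_cases his : i = s
      · rw [his, hk, Equiv.Perm.mul_apply, Equiv.swap_apply_right, hρ k le_rfl]
      · rw [ha i (by omega) fun h => hiO (by simp [h, his]), Equiv.Perm.mul_apply,
          Equiv.swap_apply_of_ne_of_ne hik his]
    · rintro i (rfl | ⟨hi, his⟩)
      · have h₁ := (moveAt_eq_H.1 hmk).2
        rw [hinv] at h₁
        have h₂ : i ≤ π i := by omega
        refine lt_of_le_of_ne h₂ fun h => ?_
        have := π.injective (hk.trans h)
        omega
      · refine lt_of_le_of_ne (hb i hi) fun h => his ?_
        exact π.injective (h.symm.trans hk.symm)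

/-- The two swaps send `k` to `ρ s` and `t` to `k`, and leave `ρ t` as the placeholder at `s` if `s
≠ t`. The case `s = t` is allowed and needs no separate treatment, which is why a `D` has `h * h`
possibilities. -/
theorem extends_D (hlen : k < mz.length) (hO : ∀ i ∈ O, i < k)
    (hρ : ∀ i, k ≤ i → ρ i = i) (hm : mz[k]? = some .D) (hs : s ∈ O) (ht : t ∈ O) :
    Extends mz (k + 1) (O \ {t}) (ρ * Equiv.swap k s * Equiv.swap s t) π ↔
      Extends mz k O ρ π ∧ π k = ρ s ∧ π t = k := by
  have hsk := hO s hs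
  have htk := hO t ht
  have hρs := apply_lt hρ hsk
  have hvk : (ρ * Equiv.swap k s * Equiv.swap s t) k = ρ s := by
    rw [Equiv.Perm.mul_apply, Equiv.swap_apply_of_ne_of_ne (by omega) (by omega),
      Equiv.Perm.mul_apply, Equiv.swap_apply_left]
  have hvt : (ρ * Equiv.swap k s * Equiv.swap s t) t = k := by
    rw [Equiv.Perm.mul_apply, Equiv.swap_apply_right, Equiv.Perm.mul_apply,
      Equiv.swap_apply_right, hρ k le_rfl]
  have hv : ∀ i < k, i ∉ O → (ρ * Equiv.swap k s * Equiv.swap s t) i = ρ i := by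
    intro i hi hiO
    have h₁ : i ≠ s := fun h => hiO (h ▸ hs)
    have h₂ : i ≠ t := fun h => hiO (h ▸ ht)
    rw [Equiv.Perm.mul_apply, Equiv.swap_apply_of_ne_of_ne h₁ h₂, Equiv.Perm.mul_apply,
      Equiv.swap_apply_of_ne_of_ne (by omega) h₁]
  apply extends_succ_iff hlen hm
  · intro ha hb
    have hk : π k = ρ s := by
      rw [ha k (by omega) fun h => (hO k h.1).false, hvk]
    have hk' : π t = k := by rw [ha t (by omega) (by simp), hvt]
    refine ⟨moveAt_eq_D.2 ⟨by omega, ?_⟩, fun i hi hiO => ?_, fun i hi => ?_, hk, hk'⟩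
    · rw [Equiv.Perm.inv_eq_iff_eq.2 hk'.symm]
      exact htk
    · rw [ha i (by omega) fun h => hiO h.1, hv i hi hiO]
    · by_cases hit : i = t
      · rw [hit, hk']
      · have := hb i ⟨hi, hit⟩
        omega
  · rintro - ha hb ⟨hk, hk'⟩
    refine ⟨fun i hi hiO => ?_, fun i hi => ?_⟩
    · rcases Nat.lt_succ_iff_lt_or_eq.1 hi with h | rfl
      · by_cases hit : i = t
        · rw [hit, hk', hvt]
        · have hiO' : i ∉ O := fun h => hiO ⟨h, hit⟩
          rw [ha i h hiO', hv i h hiO']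
      · rw [hk, hvk]
    · refine lt_of_le_of_ne (hb i hi.1) fun h => hi.2 ?_
      exact π.injective (h.symm.trans hk'.symm)

end extensions

/-! ### Codes of permutations -/

/-- The one-line notation of a permutation of the first `n` natural numbers. -/
def codeOf (n : ℕ) (π : Equiv.Perm ℕ) : List ℕ := (List.range n).map fun i => π i + 1

/-- The one-line notations of the permutations of the first `n` natural numbers for which `E`
holds. -/
def codes (n : ℕ) (E : Equiv.Perm ℕ → Prop) : Set (List ℕ) :=
  {l | ∃ π, (∀ i, n ≤ i → π i = i) ∧ E π ∧ codeOf n π = l}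

theorem codes_congr {n : ℕ} {E E' : Equiv.Perm ℕ → Prop} (h : ∀ π, E π ↔ E' π) :
    codes n E = codes n E' := by
  have : E = E' := funext fun π => propext (h π)
  rw [this]

theorem eq_of_codeOf_eq {n : ℕ} {π π' : Equiv.Perm ℕ} (h : ∀ i, n ≤ i → π i = i)
    (h' : ∀ i, n ≤ i → π' i = i) (hc : codeOf n π = codeOf n π') : π = π' := by
  ext i
  rcases lt_or_ge i n with hi | hi
  · have := List.map_inj_left.1 hc i (List.mem_range.2 hi)
    omega
  · rw [h i hi, h' i hi]

/-- A random choice which decides exactly one of `N` equally likely properties. -/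
theorem Samples.rand_codes {k : List Prog} {s : Store} {T w x N n : ℕ} {e : Expr}
    {E : Equiv.Perm ℕ → Prop} {C : ℕ → Equiv.Perm ℕ → Prop} (hN : e.val s + 1 = N)
    (h : ∀ r < N, Samples (k, s.setVar x r) T (codes n fun π => E π ∧ C r π) w)
    (hC : ∀ π, E π → ∃ r < N, C r π ∧ ∀ r' < N, C r' π → r' = r) (hw : 0 < w) :
    Samples (.rand x e :: k, s) (T + 1) (codes n E) (N * w) := by
  refine Samples.rand hN h ?_ ?_
  · rintro r - l ⟨π, h₁, h₂, rfl⟩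
    exact ⟨π, h₁, h₂.1, rfl⟩
  · rintro l ⟨π, h₁, h₂, rfl⟩
    obtain ⟨r, hr, hCr, huniq⟩ := hC π h₂
    -- A permutation can be recovered from its code, so exactly one outcome of the draw can lead to
    -- it.
    refine ⟨{r}, w, fun r' => ?_, fun _ _ => rfl, by simp, hw⟩
    rw [Finset.mem_singleton]
    constructor
    · rintro rfl
      exact ⟨hr, π, h₁, ⟨h₂, hCr⟩, rfl⟩
    · rintro ⟨hr', π', h₁', h₂', heq⟩
      rw [eq_of_codeOf_eq h₁' h₁ heq] at h₂'
      exact huniq r' hr' h₂'.2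

/-- Permutations of `Fin n` are replaced by permutations of `ℕ` that fix everything from `n` on, so
that partial labelings of different lengths live in one type. With nothing labelled yet, the
extension condition just says that the path is `mz`. -/
theorem permCode_image_eq {mz : List Move} {n : ℕ} (hn : mz.length = n) :
    permCode '' {π : Equiv.Perm (Fin n) | pathOf π = mz} = codes n (Extends mz 0 ∅ 1) := by
  have key : ∀ (σ : Equiv.Perm (Fin n)) (π : Equiv.Perm ℕ), (∀ i : Fin n, π i = σ i) →
      (∀ i : Fin n, π⁻¹ i = (σ⁻¹ i : Fin n)) → permCode σ = codeOf n π ∧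
      (pathOf σ = mz ↔ Extends mz 0 ∅ 1 π) := by
    intro σ π h₁ h₂
    constructor
    · refine List.ext_getElem (by simp [permCode, codeOf]) fun i hi hi' => ?_
      have hin : i < n := by simpa [permCode] using hi
      simp [permCode, codeOf, ← h₁ ⟨i, hin⟩]
    · have hm : ∀ i : Fin n, (if i < σ i ∧ i < σ⁻¹ i then Move.U
          else if σ i < i ∧ σ⁻¹ i < i then .D else .H) = moveAt π i := by
        intro i
        simp only [moveAt, Fin.lt_def, h₁, h₂]
      simp only [Extends, pathOf, hm, Set.mem_empty_iff_false, not_lt_zero, false_imp_iff,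
        implies_true, true_and, Nat.zero_le, true_imp_iff, hn]
      constructor
      · rintro rfl i hi
        simp [hi]
      · intro h
        refine List.ext_getElem (by simp [hn]) fun i hi hi' => ?_
        have := h i (by omega)
        rw [List.getElem?_eq_getElem hi', Option.some.injEq] at this
        simp [this]
  ext l
  constructor
  · rintro ⟨σ, hσ, rfl⟩
    set π := σ.extendDomain Fin.equivSubtype with hπ
    have h₁ : ∀ i : Fin n, π i = σ i := fun i => by
      exact σ.extendDomain_apply_image Fin.equivSubtype i
    have h₂ : ∀ i : Fin n, π⁻¹ i = (σ⁻¹ i : Fin n) := fun i => by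
      exact (σ⁻¹).extendDomain_apply_image Fin.equivSubtype i
    obtain ⟨h₃, h₄⟩ := key σ π h₁ h₂
    refine ⟨π, fun i hi => ?_, h₄.1 hσ, h₃.symm⟩
    exact Equiv.Perm.extendDomain_apply_not_subtype _ _ (by omega)
  · rintro ⟨π, hπ, hE, rfl⟩
    have hπ' : ∀ i, n ≤ i → π⁻¹ i = i := fun i hi => Equiv.Perm.inv_eq_iff_eq.2 (hπ i hi).symm
    let σ : Equiv.Perm (Fin n) :=
      { toFun := fun i => ⟨π i, apply_lt hπ i.isLt⟩
        invFun := fun i => ⟨π⁻¹ i, apply_lt hπ' i.isLt⟩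
        left_inv := fun i => by simp
        right_inv := fun i => by simp }
    obtain ⟨h₃, h₄⟩ := key σ π (fun _ => rfl) (fun _ => rfl)
    exact ⟨σ, h₄.2 hE, h₃⟩

/-! ### Sampling permutations -/

/-- Exchanges the entries of `a₀` at the positions in `x` and `y`. -/
def swapProg (x y : ℕ) : Prog :=
  .seq (.set 5 (.get 0 (.var x))) <| .seq (.put 0 (.var x) (.get 0 (.var y)))
    (.put 0 (.var y) (.var 5))

theorem Samples.swap {x y : ℕ} (hx : x ≠ 5) (hy : y ≠ 5) {k : List Prog} {s : Store} {T W : ℕ}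
    {X : Set (List ℕ)}
    (h : ∀ s' : Store, (∀ v, v ≠ 5 → s'.var v = s.var v) →
      (∀ j, s'.arr 0 j = s.arr 0 (Equiv.swap (s.var x) (s.var y) j)) →
      (∀ a, a ≠ 0 → s'.arr a = s.arr a) → Samples (k, s') T X W) :
    Samples (swapProg x y :: k, s) (T + 5) X W := by
  refine .seq (.set (.seq (.put (.put (h _ ?_ ?_ ?_)))))
  · intro v hv
    simp [hv]
  · intro j
    simp only [Expr.val, Store.setArr_arr, Store.setVar_arr, Store.setVar_var, Store.setArr_var,
      hx, hy, if_false, true_and, if_true, Equiv.swap_apply_def]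
    split_ifs <;> simp_all
  · intro a ha
    ext j
    simp [ha]

/-- The positions without an image are in `a₂`, their number is in `x₂`, and the current position
is in `x₁`. A move `U` adds the current position to them. -/
def upProg : Prog :=
  .seq (.put 2 (.var 2) (.var 1)) (.set 2 (.add (.var 2) (.const 1)))

/-- At a move `H`, the current position gets one of the free values as its image, or becomes the
image of one of the positions without an image, or is fixed. -/
def flatProg : Prog :=
  .seq (.rand 3 (.add (.var 2) (.var 2))) <|
    .cond (.sub (.var 2) (.var 3))
      (.seq (.set 6 (.get 2 (.var 3))) (swapProg 1 6))
      (.cond (.sub (.add (.var 2) (.var 2)) (.var 3))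
        (.seq (.set 3 (.sub (.var 3) (.var 2))) <| .seq (.set 6 (.get 2 (.var 3))) <|
          .seq (swapProg 1 6) (.put 2 (.var 3) (.var 1)))
        (.set 3 (.const 0)))

/-- At a move `D`, the current position gets one of the free values as its image, and it becomes
the image of one of the positions without an image. -/
def downProg : Prog :=
  .seq (.rand 3 (.sub (.var 2) (.const 1))) <| .seq (.rand 4 (.sub (.var 2) (.const 1))) <|
  .seq (.set 6 (.get 2 (.var 3))) <| .seq (.set 7 (.get 2 (.var 4))) <|
  .seq (swapProg 1 6) <| .seq (swapProg 6 7) <|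
  .seq (.set 2 (.sub (.var 2) (.const 1))) (.put 2 (.var 4) (.get 2 (.var 2)))

/-- Processes the moves of the path one after the other. -/
def labelLoop : Prog :=
  .loop (.sub (.var 0) (.var 1)) <|
    .seq (.cond (.get 1 (.var 1))
      (.cond (.sub (.get 1 (.var 1)) (.const 1)) upProg flatProg) downProg)
      (.set 1 (.add (.var 1) (.const 1)))

/-- Copies the path to `a₁`, and stores the identity in `a₀`. -/
def initLoop : Prog :=
  .loop (.var 1) <| .seq (.set 1 (.sub (.var 1) (.const 1))) <|
    .seq (.put 1 (.var 1) (.get 0 (.var 1))) (.put 0 (.var 1) (.add (.var 1) (.const 1)))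

/-- The program that samples the permutations of a given path. -/
def labelProg : Prog :=
  .seq (.set 1 (.var 0)) <| .seq initLoop <| .seq (.set 2 (.const 0)) labelLoop

/-- The first `h` entries of an array. -/
def entries (o : ℕ → ℕ) (h : ℕ) : Set ℕ := {x | ∃ j < h, o j = x}

/-- The memory after `k` steps of the labelling of a path, with `h` positions without an image. -/
structure LabelState (mz : List Move) (s : Store) (k h : ℕ) (ρ : Equiv.Perm ℕ) : Prop where
  var_zero : s.var 0 = mz.length
  var_one : s.var 1 = k
  var_two : s.var 2 = h
  le : k ≤ mz.length
  arr_zero : ∀ j < mz.length, s.arr 0 j = ρ j + 1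
  arr_one : ∀ (j : ℕ) (m : Move), mz[j]? = some m → s.arr 1 j = m.code
  fix : ∀ j, k ≤ j → ρ j = j
  lt : ∀ x ∈ entries (s.arr 2) h, x < k
  inj : ∀ i < h, ∀ j < h, s.arr 2 i = s.arr 2 j → i = j
  descends : Descends h (mz.drop k)

/-! ### The list of open positions and the memory after one labelling step. -/

section steps

variable {mz : List Move} {s s' : Store} {k h : ℕ} {ρ : Equiv.Perm ℕ}

theorem entries_push {o o' : ℕ → ℕ} (ho : ∀ j, o' j = if j = h then k else o j) :
    entries o' (h + 1) = insert k (entries o h) := by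
  ext x
  simp only [entries, Set.mem_ofPred_eq, Set.mem_insert_iff]
  constructor
  · rintro ⟨j, hj, rfl⟩
    rw [ho]
    split_ifs with hjh
    · exact Or.inl rfl
    · exact Or.inr ⟨j, by omega, rfl⟩
  · rintro (rfl | ⟨j, hj, rfl⟩)
    · exact ⟨h, by omega, by simp [ho]⟩
    · exact ⟨j, by omega, by rw [ho, if_neg (by omega)]⟩

theorem entries_replace {o o' : ℕ → ℕ} {r : ℕ} (hr : r < h)
    (inj : ∀ i < h, ∀ j < h, o i = o j → i = j) (ho : ∀ j, o' j = if j = r then k else o j) :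
    entries o' h = insert k (entries o h \ {o r}) := by
  ext x
  simp only [entries, Set.mem_ofPred_eq, Set.mem_insert_iff, Set.mem_sdiff,
    Set.mem_singleton_iff]
  constructor
  · rintro ⟨j, hj, rfl⟩
    rw [ho]
    split_ifs with hjr
    · exact Or.inl rfl
    · exact Or.inr ⟨⟨j, hj, rfl⟩, fun he => hjr (inj j hj r hr he)⟩
  · rintro (rfl | ⟨⟨j, hj, rfl⟩, hne⟩)
    · exact ⟨r, hr, by simp [ho]⟩
    · refine ⟨j, hj, ?_⟩
      rw [ho, if_neg fun he => hne (by rw [he])]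

theorem entries_remove {o o' : ℕ → ℕ} {r : ℕ} (hr : r < h)
    (inj : ∀ i < h, ∀ j < h, o i = o j → i = j)
    (ho : ∀ j, o' j = if j = r then o (h - 1) else o j) :
    entries o' (h - 1) = entries o h \ {o r} := by
  ext x
  simp only [entries, Set.mem_ofPred_eq, Set.mem_sdiff, Set.mem_singleton_iff]
  constructor
  · rintro ⟨j, hj, rfl⟩
    rw [ho]
    split_ifs with hjr
    · refine ⟨⟨h - 1, by omega, rfl⟩, fun he => ?_⟩
      have := inj (h - 1) (by omega) r hr he
      omega
    · exact ⟨⟨j, by omega, rfl⟩, fun he => hjr (inj j (by omega) r hr he)⟩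
  · rintro ⟨⟨j, hj, rfl⟩, hne⟩
    have hjr : j ≠ r := fun he => hne (by rw [he])
    by_cases hj' : j = h - 1
    · exact ⟨r, by omega, by rw [ho, if_pos rfl, hj']⟩
    · exact ⟨j, by omega, by rw [ho, if_neg hjr]⟩

theorem LabelState.step_U (hs : LabelState mz s k h ρ) (hk : k < mz.length)
    (hd : Descends (h + 1) (mz.drop (k + 1)))
    (h₀ : s'.var 0 = s.var 0) (h₁ : s'.var 1 = k + 1) (h₂ : s'.var 2 = h + 1)
    (a₀ : s'.arr 0 = s.arr 0) (a₁ : s'.arr 1 = s.arr 1)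
    (a₂ : ∀ j, s'.arr 2 j = if j = h then k else s.arr 2 j) :
    LabelState mz s' (k + 1) (h + 1) ρ where
  var_zero := by rw [h₀, hs.var_zero]
  var_one := h₁
  var_two := h₂
  le := hk
  arr_zero := by rw [a₀]; exact hs.arr_zero
  arr_one := by rw [a₁]; exact hs.arr_one
  fix j hj := hs.fix j (by omega)
  lt := by
    rw [entries_push a₂]
    rintro x (rfl | hx)
    · omega
    · have := hs.lt x hx
      omega
  inj := by
    have hne : ∀ j < h, s.arr 2 j ≠ k := fun j hj => (hs.lt _ ⟨j, hj, rfl⟩).ne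
    intro i hi j hj
    rw [a₂, a₂]
    split_ifs with h₃ h₄ h₄
    · omega
    · intro he
      exact absurd he.symm (hne j (by omega))
    · intro he
      exact absurd he (hne i (by omega))
    · exact hs.inj i (by omega) j (by omega)
  descends := hd

theorem LabelState.step_H (hs : LabelState mz s k h ρ) (hk : k < mz.length)
    (hd : Descends h (mz.drop (k + 1))) {ρ' : Equiv.Perm ℕ}
    (h₀ : s'.var 0 = s.var 0) (h₁ : s'.var 1 = k + 1) (h₂ : s'.var 2 = h)
    (a₀ : ∀ j < mz.length, s'.arr 0 j = ρ' j + 1) (a₁ : s'.arr 1 = s.arr 1)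
    (a₂ : s'.arr 2 = s.arr 2 ∨ ∃ r < h, ∀ j, s'.arr 2 j = if j = r then k else s.arr 2 j)
    (hρ : ∀ j, k + 1 ≤ j → ρ' j = j) : LabelState mz s' (k + 1) h ρ' where
  var_zero := by rw [h₀, hs.var_zero]
  var_one := h₁
  var_two := h₂
  le := hk
  arr_zero := a₀
  arr_one := by rw [a₁]; exact hs.arr_one
  fix := hρ
  lt := by
    rcases a₂ with a₂ | ⟨r, hr, a₂⟩
    · rw [a₂]
      intro x hx
      have := hs.lt x hx
      omega
    · rw [entries_replace hr hs.inj a₂]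
      rintro x (rfl | ⟨hx, -⟩)
      · omega
      · have := hs.lt x hx
        omega
  inj := by
    rcases a₂ with a₂ | ⟨r, hr, a₂⟩
    · rw [a₂]
      exact hs.inj
    · have hne : ∀ j < h, s.arr 2 j ≠ k := fun j hj => (hs.lt _ ⟨j, hj, rfl⟩).ne
      intro i hi j hj
      rw [a₂, a₂]
      split_ifs with h₃ h₄ h₄
      · omega
      · intro he
        exact absurd he.symm (hne j (by omega))
      · intro he
        exact absurd he (hne i (by omega))
      · exact hs.inj i hi j hj
  descends := hd

theorem LabelState.step_D (hs : LabelState mz s k h ρ) (hk : k < mz.length)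
    (hd : Descends (h - 1) (mz.drop (k + 1))) {ρ' : Equiv.Perm ℕ}
    (h₀ : s'.var 0 = s.var 0) (h₁ : s'.var 1 = k + 1) (h₂ : s'.var 2 = h - 1)
    (a₀ : ∀ j < mz.length, s'.arr 0 j = ρ' j + 1) (a₁ : s'.arr 1 = s.arr 1) {r : ℕ} (hr : r < h)
    (a₂ : ∀ j, s'.arr 2 j = if j = r then s.arr 2 (h - 1) else s.arr 2 j)
    (hρ : ∀ j, k + 1 ≤ j → ρ' j = j) : LabelState mz s' (k + 1) (h - 1) ρ' where
  var_zero := by rw [h₀, hs.var_zero]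
  var_one := h₁
  var_two := h₂
  le := hk
  arr_zero := a₀
  arr_one := by rw [a₁]; exact hs.arr_one
  fix := hρ
  lt := by
    rw [entries_remove hr hs.inj a₂]
    rintro x ⟨hx, -⟩
    have := hs.lt x hx
    omega
  inj := by
    intro i hi j hj
    rw [a₂, a₂]
    split_ifs with h₃ h₄ h₄
    · omega
    · intro he
      have := hs.inj _ (by omega) _ (by omega) he
      omega
    · intro he
      have := hs.inj _ (by omega) _ (by omega) he
      omega
    · exact hs.inj i (by omega) j (by omega)
  descends := hd

theorem swap_fix {a b : ℕ} (ha : a ≤ k) (hb : b ≤ k) (hρ : ∀ j, k + 1 ≤ j → ρ j = j) (j : ℕ)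
    (hj : k + 1 ≤ j) : (ρ * Equiv.swap a b) j = j := by
  rw [Equiv.Perm.mul_apply, Equiv.swap_apply_of_ne_of_ne (by omega) (by omega), hρ j hj]

theorem swap_lt {a b j n : ℕ} (ha : a < n) (hb : b < n) (hj : j < n) : Equiv.swap a b j < n := by
  rw [Equiv.swap_apply_def]
  split_ifs <;> assumption

end steps

/-- Induction on the number of moves still to be labelled. Each draw splits the extensions of the
current partial labelling into equally weighted disjoint classes, so the weights multiply to
`labelings`. -/
theorem samples_labelLoop {mz : List Move} {N : ℕ} {s : Store} {k h : ℕ} {ρ : Equiv.Perm ℕ}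
    (hs : LabelState mz s k h ρ) (hN : mz.length = k + N) :
    Samples ([labelLoop], s) (30 * N + 1)
      (codes mz.length (Extends mz k (entries (s.arr 2) h) ρ)) (labelings h (mz.drop k)) := by
  induction N generalizing s k h ρ with
  | zero =>
    have hd := hs.descends
    rw [List.drop_eq_nil_of_le (by omega)] at hd ⊢
    have hh : h = 0 := hd
    subst hh
    refine Samples.loop_zero (by simp [Expr.val, hs.var_zero, hs.var_one, hN])
      ((samples_nil s _).congr ?_ rfl)
    have hout : s.output = codeOf mz.length ρ := by
      rw [Store.output, codeOf, hs.var_zero]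
      exact List.map_congr_left fun i hi => hs.arr_zero i (List.mem_range.1 hi)
    ext l
    rw [Set.mem_singleton_iff, hout]
    constructor
    · rintro rfl
      -- At the end the height is `0`, so no position is open and `ρ` itself is the only extension.
      exact ⟨ρ, fun i hi => hs.fix i (by omega), ⟨fun _ _ _ => rfl, by simp [entries],
        fun i _ _ => by omega⟩, rfl⟩
    · rintro ⟨π, hπ, hE, rfl⟩
      exact List.map_congr_left fun i hi => by
        rw [hE.1 i (by have := List.mem_range.1 hi; omega) (by simp [entries])]
  | succ N ih =>
    have hk : k < mz.length := by omega
    have hd := hs.descends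
    have v₁ := hs.var_one
    have v₂ := hs.var_two
    have hsk : ∀ j, k + 1 ≤ j → ρ j = j := fun j hj => hs.fix j (by omega)
    have ho : ∀ j < h, s.arr 2 j ∈ entries (s.arr 2) h := fun j hj => ⟨j, hj, rfl⟩
    have hok : ∀ j < h, s.arr 2 j < k := fun j hj => hs.lt _ (ho j hj)
    rw [List.drop_eq_getElem_cons hk] at hd ⊢
    have hm? := List.getElem?_eq_getElem hk
    obtain ⟨m, hm⟩ : ∃ m, mz[k] = m := ⟨_, rfl⟩
    rw [hm] at hd hm? ⊢
    have hcode := hs.arr_one k m hm?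
    refine Samples.mono (T := 30 * N + 1 + 30) ?_ (by omega)
    refine .loop_pos (by simp [Expr.val, hs.var_zero, v₁]; omega) (.seq ?_)
    cases m with
    | U =>
      refine .cond_pos (by simp [Expr.val, v₁, hcode, Move.code]) (.cond_pos
        (by simp [Expr.val, v₁, hcode, Move.code]) (.seq (.put (.set (.set ?_)))))
      refine Samples.mono (T := 30 * N + 1) ?_ (by omega)
      refine (ih (hs.step_U hk hd ?_ ?_ ?_ ?_ ?_ ?_) (by omega)).congr
        (codes_congr fun π => ?_) rfl
      · simp
      · simp [Expr.val, v₁]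
      · simp [Expr.val, v₂]
      · ext j; simp
      · ext j; simp
      · intro j; simp [Expr.val, v₁, v₂]
      · rw [entries_push (o := s.arr 2) (k := k) fun j => by simp [Expr.val, v₁, v₂]]
        exact extends_U hk hs.lt hs.fix hm?
    | H =>
      refine .cond_pos (by simp [Expr.val, v₁, hcode, Move.code]) (.cond_zero
        (by simp [Expr.val, v₁, hcode, Move.code]) (.seq ?_))
      -- The first `h` outcomes choose a value for `k`, the next `h` a position mapped to `k`, and
      -- the last one makes `k` a fixed point.
      refine Samples.rand_codes (N := 2 * h + 1) (by simp [Expr.val, v₂]; omega)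
        (C := fun r π => if r < h then π k = ρ (s.arr 2 r)
          else if r < h + h then π (s.arr 2 (r - h)) = k else π k = k) ?_ ?_
        (labelings_pos hd)
      · intro r hr
        by_cases h₁ : r < h
        · refine .cond_pos (by simp [Expr.val, v₂]; omega) (.seq (.set
            (Samples.swap (by omega) (by omega) fun s' hv ha₀ ha => .set ?_)))
          refine Samples.mono (T := 30 * N + 1) ?_ (by omega)
          have hkr := hok r h₁
          simp [Expr.val, v₁] at ha₀
          refine (ih (hs.step_H hk hd (ρ' := ρ * Equiv.swap k (s.arr 2 r)) ?_ ?_ ?_ ?_ ?_ ?_ ?_)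
            (by omega)).congr (codes_congr fun π => ?_) rfl
          · simp [hv]
          · simp [Expr.val, hv, v₁]
          · simp [hv, v₂]
          · intro j hj
            simp only [Store.setVar_arr, ha₀]
            rw [hs.arr_zero _ (swap_lt hk (by omega) hj), Equiv.Perm.mul_apply]
          · simp [ha]
          · exact Or.inl (by simp [ha])
          · exact swap_fix le_rfl hkr.le hsk
          · simp only [Store.setVar_arr, ha 2 (by omega), h₁, if_true]
            exact extends_value hk hs.lt hs.fix hm? (ho r h₁)
        by_cases h₂ : r < h + h
        · refine .cond_zero (by simp [Expr.val, v₂]; omega) (.cond_pos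
            (by simp [Expr.val, v₂]; omega) (.seq (.set (.seq (.set (.seq
            (Samples.swap (by omega) (by omega) fun s' hv ha₀ ha => .put (.set ?_))))))))
          refine Samples.mono (T := 30 * N + 1) ?_ (by omega)
          have hrh : r - h < h := by omega
          have hkr := hok _ hrh
          simp [Expr.val, v₁, v₂] at ha₀
          refine (ih (hs.step_H hk hd (ρ' := ρ * Equiv.swap k (s.arr 2 (r - h)))
            ?_ ?_ ?_ ?_ ?_ ?_ ?_) (by omega)).congr (codes_congr fun π => ?_) rfl
          · simp [hv]
          · simp [Expr.val, hv, v₁]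
          · simp [hv, v₂]
          · intro j hj
            simp only [Store.setVar_arr, Store.setArr_arr, ha₀]
            simp only [OfNat.zero_ne_ofNat, false_and, if_false]
            rw [hs.arr_zero _ (swap_lt hk (by omega) hj), Equiv.Perm.mul_apply]
          · ext j; simp [ha]
          · exact Or.inr ⟨r - h, hrh, fun j => by simp [Expr.val, ha, hv, v₁, v₂]⟩
          · exact swap_fix le_rfl hkr.le hsk
          · rw [entries_replace (o := s.arr 2) (k := k) hrh hs.inj fun j => by
              simp [Expr.val, ha, hv, v₁, v₂]]
            simp only [h₁, h₂, if_true, if_false]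
            exact extends_source hk hs.lt hs.fix hm? (ho _ hrh)
        · refine .cond_zero (by simp [Expr.val, v₂]; omega) (.cond_zero
            (by simp [Expr.val, v₂]; omega) (.set (.set ?_)))
          refine Samples.mono (T := 30 * N + 1) ?_ (by omega)
          refine (ih (hs.step_H hk hd (ρ' := ρ) ?_ ?_ ?_ ?_ ?_ ?_ hsk)
            (by omega)).congr (codes_congr fun π => ?_) rfl
          · simp
          · simp [Expr.val, v₁]
          · simp [v₂]
          · exact hs.arr_zero
          · rfl
          · exact Or.inl rfl
          · simp only [h₁, h₂, if_false]
            exact extends_fixed hk hs.lt hs.fix hm?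
      · intro π hE
        have hmk := hE.2.2 k le_rfl hk
        rw [hm?, Option.some.injEq, eq_comm, moveAt_eq_H] at hmk
        have hval : ∀ r < h, ρ (s.arr 2 r) < k := fun r hr => apply_lt hs.fix (hok r hr)
        -- At an `H`, the cases `π k < k`, `π k = k` and `π k > k` call for a free value, a fixed
        -- point and an open position respectively; in the last case the move not being `U` forces
        -- the preimage of `k` below `k`.
        rcases lt_trichotomy (π k) k with hlt | heq | hgt
        · obtain ⟨_, ⟨r, hr, rfl⟩, hx⟩ := hE.exists_value hs.fix hlt
          refine ⟨r, by omega, by simp [hr, hx], fun r' hr' hC => ?_⟩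
          split_ifs at hC with h₁ h₂
          · exact hs.inj r' h₁ r hr (ρ.injective (hC.symm.trans hx))
          · refine absurd ⟨hlt, ?_⟩ hmk.2
            rw [Equiv.Perm.inv_eq_iff_eq.2 hC.symm]
            exact hok _ (by omega)
          · omega
        · refine ⟨h + h, by omega, by simp [heq], fun r' hr' hC => ?_⟩
          split_ifs at hC with h₁ h₂
          · have := hval r' h₁
            omega
          · have := π.injective (hC.trans heq.symm)
            have := hok (r' - h) (by omega)
            omega
          · omega
        · have hinv : π⁻¹ k ≤ k := by
            by_contra hc
            exact hmk.1 ⟨hgt, by omega⟩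
          obtain ⟨x, hx⟩ := π.surjective k
          rw [Equiv.Perm.inv_eq_iff_eq.2 hx.symm] at hinv
          have hxk : x ≠ k := by
            rintro rfl
            omega
          obtain ⟨r, hr, rfl⟩ := hE.mem_of_apply_eq hs.fix (by omega) hx
          refine ⟨h + r, by omega, by simp [hx, hr], fun r' hr' hC => ?_⟩
          split_ifs at hC with h₁ h₂
          · have := hval r' h₁
            omega
          · have := hs.inj _ (by omega) _ hr (π.injective (hC.trans hx.symm))
            omega
          · omega
    | D =>
      have hpos : 0 < h := hd.1
      refine .cond_zero (by simp [Expr.val, v₁, hcode, Move.code]) (.seq ?_)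
      rw [labelings, mul_assoc]
      refine Samples.rand_codes (by simp [Expr.val, v₂]; omega)
        (C := fun a π => π k = ρ (s.arr 2 a)) (fun a ha => .seq ?_) (fun π hE => ?_)
        (Nat.mul_pos hpos (labelings_pos hd.2))
      · refine Samples.rand_codes (by simp [Expr.val, v₂]; omega)
          (C := fun b π => π (s.arr 2 b) = k) (fun b hb => ?_) (fun π hE => ?_)
          (labelings_pos hd.2)
        · have hka := hok a ha
          have hkb := hok b hb
          refine .seq (.set (.seq (.set (.seq (Samples.swap (by omega) (by omega)
            fun s₁ hv₁ ha₁ har₁ => .seq (Samples.swap (by omega) (by omega)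
            fun s₂ hv₂ ha₂ har₂ => .seq (.set (.put (.set ?_)))))))))
          refine Samples.mono (T := 30 * N + 1) ?_ (by omega)
          simp [Expr.val, v₁] at ha₁
          simp [Expr.val, hv₁, ha₁] at ha₂
          refine (ih (hs.step_D hk hd.2 (r := b)
            (ρ' := ρ * Equiv.swap k (s.arr 2 a) * Equiv.swap (s.arr 2 a) (s.arr 2 b))
            ?_ ?_ ?_ ?_ ?_ hb ?_ ?_) (by omega)).congr (codes_congr fun π => ?_) rfl
          · simp [hv₁, hv₂]
          · simp [Expr.val, hv₁, hv₂, v₁]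
          · simp [Expr.val, hv₁, hv₂, v₂]
          · intro j hj
            simp only [Store.setVar_arr, Store.setArr_arr, ha₂]
            simp only [OfNat.zero_ne_ofNat, false_and, if_false]
            rw [hs.arr_zero _ (swap_lt hk (by omega) (swap_lt (by omega) (by omega) hj)),
              Equiv.Perm.mul_apply, Equiv.Perm.mul_apply]
          · ext j; simp [har₁, har₂]
          · intro j
            simp [Expr.val, har₁, har₂, hv₁, hv₂, v₂]
          · exact swap_fix hka.le hkb.le (swap_fix le_rfl hka.le hsk)
          · rw [entries_remove (o := s.arr 2) hb hs.inj fun j => by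
              simp [Expr.val, har₁, har₂, hv₁, hv₂, v₂], and_assoc]
            exact extends_D hk hs.lt hs.fix hm? (ho a ha) (ho b hb)
        · have hmk := hE.1.2.2 k le_rfl hk
          rw [hm?, Option.some.injEq, eq_comm, moveAt_eq_D] at hmk
          obtain ⟨x, hx⟩ := π.surjective k
          rw [Equiv.Perm.inv_eq_iff_eq.2 hx.symm] at hmk
          obtain ⟨r, hr, rfl⟩ := hE.1.mem_of_apply_eq hs.fix hmk.2 hx
          exact ⟨r, hr, hx, fun r' hr' hC =>
            hs.inj _ hr' _ hr (π.injective (hC.trans hx.symm))⟩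
      · have hmk := hE.2.2 k le_rfl hk
        rw [hm?, Option.some.injEq, eq_comm, moveAt_eq_D] at hmk
        obtain ⟨_, ⟨r, hr, rfl⟩, hx⟩ := hE.exists_value hs.fix hmk.1
        exact ⟨r, hr, hx, fun r' hr' hC =>
          hs.inj _ hr' _ hr (ρ.injective (hC.symm.trans hx))⟩

theorem samples_initLoop {k : List Prog} {T : ℕ} {X : Set (List ℕ)} {W m : ℕ} {s : Store}
    (hm : s.var 1 = m)
    (h : ∀ s' : Store, s'.var 0 = s.var 0 → s'.var 1 = 0 →
      (∀ j, s'.arr 1 j = if j < m then s.arr 0 j else s.arr 1 j) →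
      (∀ j, s'.arr 0 j = if j < m then j + 1 else s.arr 0 j) →
      Samples (k, s') T X W) :
    Samples (initLoop :: k, s) (T + 6 * m + 1) X W := by
  induction m generalizing s with
  | zero =>
    exact Samples.loop_zero hm (h s rfl hm (fun j => by simp) (fun j => by simp))
  | succ m ih =>
    refine Samples.mono (T := T + 6 * m + 1 + 6) ?_ (by omega)
    refine Samples.mono (T := T + 6 * m + 1 + 1 + 1 + 1 + 1 + 1 + 1) ?_ (by omega)
    refine Samples.loop_pos (by simp [Expr.val, hm]) (.seq (.set (.seq (.put (.put
      (ih ?_ fun s' h₁ h₂ h₃ h₄ => h s' ?_ h₂ (fun j => ?_) (fun j => ?_)))))))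
    · simp [Expr.val, hm]
    · simpa using h₁
    · rw [h₃]
      simp [Expr.val, hm]
      split_ifs <;> first | rfl | omega | (congr 1; omega)
    · rw [h₄]
      simp [Expr.val, hm]
      split_ifs <;> first | rfl | omega

theorem samples_labelProg {n A : ℕ} {mz : List Move} (hmz : mz ∈ MZ n A) {s : Store}
    (hs : s.output = pathCode mz) :
    Samples ([labelProg], s) (36 * n + 10)
      (permCode '' {π : Equiv.Perm (Fin n) | pathOf π = mz}) (labelings 0 mz) := by
  obtain ⟨hlen, hd, -⟩ := mem_MZ.1 hmz
  subst hlen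
  obtain ⟨hs₀, hs₁⟩ := Store.output_eq_iff.1 hs
  have hs₀' : s.var 0 = mz.length := by rw [hs₀, pathCode, List.length_map]
  refine Samples.mono (T := (30 * mz.length + 1 + 2) + 6 * mz.length + 1 + 3) ?_ (by omega)
  refine .seq (.set (.seq (samples_initLoop (by simp [Expr.val, hs₀'])
    fun s' h₁ h₂ h₃ h₄ => .seq (.set ?_))))
  have h₁' : s'.var 0 = mz.length := by rw [h₁]; simp [hs₀']
  refine (samples_labelLoop (mz := mz) (k := 0) (h := 0) (ρ := 1) ?_ (by omega)).congr ?_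
    (by simp)
  · constructor
    · simp [h₁']
    · simp [h₂]
    · simp [Expr.val]
    · omega
    · intro j hj
      simp [h₄, hj]
    · intro j m hj
      obtain ⟨hj', hjm⟩ := List.getElem?_eq_some_iff.1 hj
      simp only [Store.setVar_arr, h₃, hj', if_true]
      rw [hs₁ j (by simpa [pathCode] using hj'), List.getD_eq_getElem _ _ (by simpa [pathCode])]
      simp [pathCode, hjm]
    · intro j _
      rfl
    · simp [entries]
    · intro i hi
      omega
    · simpa using hd
  · rw [permCode_image_eq rfl]
    simp [entries]

/-! ### The path of a permutation -/

section pathOf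

variable {n : ℕ} (π : Equiv.Perm (Fin n))

theorem permCode_injective : Function.Injective (permCode (n := n)) := by
  intro π σ h
  ext i
  have := congrFun (List.ofFn_injective h) i
  omega

theorem height_succ {mz : List Move} {k : ℕ} (hk : k < mz.length) :
    height mz (k + 1) = height mz k + mz[k].rise := by
  rw [height, height, List.take_add_one, List.getElem?_eq_getElem hk, List.map_append,
    List.sum_append]
  simp

/-- The height of the path at `k` is the number of the elements before `k` with images from
`k` on. -/
theorem height_pathOf {k : ℕ} (hk : k ≤ n) :
    height (pathOf π) k = ∑ j : Fin n, if (j : ℕ) < k ∧ k ≤ π j then 1 else 0 := by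
  induction k with
  | zero => simp [height_zero]
  | succ k ih =>
    have hlen : k < (pathOf π).length := by simpa [pathOf] using hk
    rw [height_succ hlen, ih (by omega)]
    symm
    rw [← sub_eq_iff_eq_add', ← Finset.sum_sub_distrib]
    set i : Fin n := ⟨k, hk⟩ with hi
    -- Passing from `k` to `k + 1`, the position `k` starts to count if its image is larger, and the
    -- preimage of `k` stops counting if it is smaller. At an `H` these two changes either both
    -- occur and cancel, or neither occurs.
    have hpt : ∀ j : Fin n, ((if (j : ℕ) < k + 1 ∧ k + 1 ≤ π j then 1 else 0 : ℤ) -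
        if (j : ℕ) < k ∧ k ≤ π j then 1 else 0) =
        (if j = i then (if i < π i then 1 else 0) else 0) -
          if j = π⁻¹ i then (if π⁻¹ i < i then 1 else 0) else 0 := by
      intro j
      have h₁ : j = π⁻¹ i ↔ (π j : ℕ) = k := by
        rw [Equiv.Perm.eq_inv_iff_eq, Fin.ext_iff]
      by_cases hj : j = π⁻¹ i
      · have hjk := h₁.1 hj
        rw [if_pos hj, ← hj]
        by_cases hji : j = i
        · have : (j : ℕ) = k := by rw [hji]
          rw [if_pos hji, ← hji]
          simp only [Fin.lt_def]
          split_ifs <;> omega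
        · rw [if_neg hji]
          simp only [Fin.lt_def, hi]
          split_ifs <;> omega
      · have hjk := fun h => hj (h₁.2 h)
        rw [if_neg hj]
        by_cases hji : j = i
        · have : (j : ℕ) = k := by rw [hji]
          rw [if_pos hji, ← hji]
          simp only [Fin.lt_def]
          split_ifs <;> omega
        · rw [if_neg hji]
          have : (j : ℕ) ≠ k := fun h => hji (Fin.ext h)
          split_ifs <;> omega
    rw [Finset.sum_congr rfl fun j _ => hpt j, Finset.sum_sub_distrib, Finset.sum_ite_eq',
      Finset.sum_ite_eq', if_pos (Finset.mem_univ _), if_pos (Finset.mem_univ _)]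
    have hget : (pathOf π)[k] = if i < π i ∧ i < π⁻¹ i then .U
        else if π i < i ∧ π⁻¹ i < i then .D else .H := by
      simp [pathOf, hi]
    have h₂ : π i = i ↔ π⁻¹ i = i := by
      rw [Equiv.Perm.inv_eq_iff_eq, eq_comm]
    rw [hget]
    generalize π⁻¹ i = q at h₂ ⊢
    generalize π i = p at h₂ ⊢
    rcases lt_trichotomy p i with h | h | h
    · rcases lt_or_gt_of_ne fun he => h.ne (h₂.2 he) with h₄ | h₄
      · simp [h, h₄, h.not_gt, Move.rise]
      · simp [h.not_gt, h₄.not_gt, Move.rise]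
    · simp [h, h₂.1 h, Move.rise]
    · rcases lt_or_gt_of_ne fun he => h.ne' (h₂.2 he) with h₄ | h₄
      · simp [h, h₄, h.not_gt, h₄.not_gt, Move.rise]
      · simp [h, h₄, h₄.not_gt, Move.rise]

theorem height_pathOf_self : height (pathOf π) n = 0 := by
  rw [height_pathOf π le_rfl]
  refine Finset.sum_eq_zero fun j _ => if_neg ?_
  have := (π j).isLt
  omega

/-- By double counting, the sum of the heights is the sum of the positive parts of `π j - j`. Since
these differences add up to zero, this is half the sum of their absolute values. -/
theorem sum_height_pathOf :
    ∑ k ∈ Finset.range n, (height (pathOf π) k + height (pathOf π) (k + 1)) =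
      displacement π := by
  have h₁ : ∑ k ∈ Finset.range n, height (pathOf π) (k + 1) =
      ∑ k ∈ Finset.range n, height (pathOf π) k := by
    have h₂ := Finset.sum_range_succ (height (pathOf π)) n
    rw [Finset.sum_range_succ', height_pathOf_self, height_zero, add_zero, add_zero] at h₂
    exact h₂
  have h₃ : ∑ k ∈ Finset.range n, height (pathOf π) k =
      ∑ j : Fin n, (((π j : ℕ) - (j : ℕ) : ℕ) : ℤ) := by
    rw [Finset.sum_congr rfl fun k hk => height_pathOf π (Finset.mem_range.1 hk).le,
      Finset.sum_comm]
    refine Finset.sum_congr rfl fun j _ => ?_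
    rw [Finset.sum_boole, ← Nat.card_Ioc]
    congr 2
    ext k
    have := (π j).isLt
    simp only [Finset.mem_filter, Finset.mem_range, Finset.mem_Ioc]
    omega
  have h₄ : ∑ j : Fin n, (((π j : ℕ) : ℤ) - ((j : ℕ) : ℤ)) = 0 := by
    rw [Finset.sum_sub_distrib, Equiv.sum_comp π fun j : Fin n => ((j : ℕ) : ℤ), sub_self]
  rw [Finset.sum_add_distrib, h₁, h₃, displacement, Nat.cast_sum, ← Finset.sum_add_distrib,
    ← sub_eq_zero, ← Finset.sum_sub_distrib, ← h₄]
  refine Finset.sum_congr rfl fun j _ => ?_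
  omega

theorem pathOf_mem_MZ {A : ℕ} : pathOf π ∈ MZ n A ↔ displacement π = 2 * A := by
  constructor
  · rintro ⟨-, -, -, h⟩
    rw [sum_height_pathOf] at h
    exact_mod_cast h
  · intro h
    refine ⟨by simp [pathOf], fun k hk => ?_, height_pathOf_self π, ?_⟩
    · rw [height_pathOf π hk]
      exact Finset.sum_nonneg fun j _ => by split_ifs <;> simp
    · rw [sum_height_pathOf, h]
      push_cast
      rfl

end pathOf

/-! ### Sampling the permutations of a building sequence -/

theorem P_pos {n A : ℕ} {a : List ℕ} (ha : a ∈ S n A) {mz : List Move} (hmz : mz ∈ MZ n A)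
    (h : BuiltFrom a mz) : 0 < P a := by
  refine Nat.mul_pos ?_ ?_
  · rw [← completions_eq_mult ha]
    exact completions_pos _ _ _ _
  · rw [← labelings_eq_perm ha h hmz]
    exact labelings_pos (mem_MZ.1 hmz).2.1

/-- A permutation can only arise through its own path, so the two probabilities multiply; the second
one is the same for all paths built from `a`. -/
theorem samples_pathProg_labelProg {n A : ℕ} {a : List ℕ} (ha : a ∈ S n A) {s : Store}
    (hs : s.output = a) :
    Samples ([pathProg.seq labelProg], s) (16 * n + 20 + (36 * n + 10) + 1)
      (permCode '' {π : Equiv.Perm (Fin n) | pathOf π ∈ MZ n A ∧ BuiltFrom a (pathOf π)})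
      (P a) := by
  have h₁ := samples_pathProg ha hs
  have h₂ : ∀ z ∈ (runFor (16 * n + 20) ([pathProg], s)).support,
      ∃ mz ∈ MZ n A, BuiltFrom a mz ∧ z.2.output = pathCode mz ∧
        Samples ([labelProg], z.2) (36 * n + 10)
          (permCode '' {π : Equiv.Perm (Fin n) | pathOf π = mz}) (perm a) := by
    intro z hz
    obtain ⟨mz, ⟨hmz, hb⟩, heq⟩ := h₁.output_mem hz
    exact ⟨mz, hmz, hb, heq.symm,
      (samples_labelProg hmz heq.symm).congr rfl (labelings_eq_perm ha hb hmz)⟩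
  have hH : ∀ z ∈ (runFor (16 * n + 20) ([pathProg], s)).support,
      Halts ([labelProg], z.2) (36 * n + 10) := fun z hz => by
    obtain ⟨mz, -, -, -, h₃⟩ := h₂ z hz
    exact h₃.1
  refine ⟨h₁.1.seq hH, ?_, fun l hl => ?_⟩
  · rintro _ ⟨π, ⟨hπ, hb⟩, rfl⟩
    rw [h₁.1.seq_output_apply hH (o := pathCode (pathOf π)) (w := (perm a : ℝ≥0∞)⁻¹),
      h₁.2.1 _ ⟨pathOf π, ⟨hπ, hb⟩, rfl⟩, ← ENNReal.mul_inv (Or.inr (ENNReal.natCast_ne_top _))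
      (Or.inl (ENNReal.natCast_ne_top _)), P, Nat.cast_mul]
    intro z hz
    obtain ⟨mz, -, -, ho, h₃⟩ := h₂ z hz
    rw [ho]
    split_ifs with heq
    · exact h₃.2.1 _ ⟨π, (pathCode_injective heq).symm, rfl⟩
    · refine h₃.2.2 _ ?_
      rintro ⟨σ, hσ, hσπ⟩
      rw [permCode_injective hσπ] at hσ
      exact heq (congrArg pathCode hσ.symm)
  -- With `w = 0` the choice of `o` is immaterial.
  · rw [h₁.1.seq_output_apply hH (o := []) (w := 0), mul_zero]
    intro z hz
    obtain ⟨mz, hmz, hb, ho, h₃⟩ := h₂ z hz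
    rw [ite_self]
    refine h₃.2.2 _ ?_
    rintro ⟨π, rfl, rfl⟩
    exact hl ⟨π, ⟨hmz, hb⟩, rfl⟩

theorem samplesPathOfSequence_pathProg : SamplesPathOfSequence pathProg := by
  refine ⟨16 * Polynomial.X + 20, fun n A a ha => ?_⟩
  have hT : (16 * Polynomial.X + 20 : Polynomial ℕ).eval n = 16 * n + 20 := by simp
  rw [hT]
  exact (samples_pathProg ha (Store.output_input a)).isUniformOn

theorem samplesPermutationOfPath_labelProg : SamplesPermutationOfPath labelProg := by
  refine ⟨36 * Polynomial.X + 10, fun n A mz hmz => ?_⟩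
  have hT : (36 * Polynomial.X + 10 : Polynomial ℕ).eval n = 36 * n + 10 := by simp
  rw [hT]
  exact (samples_labelProg hmz (Store.output_input _)).isUniformOn

theorem SamplesSequences.samplesPermutations {I : Set (ℕ × ℕ)} {Q : Prog}
    (hQ : SamplesSequences I Q) : SamplesPermutations I (Q.seq (pathProg.seq labelProg)) := by
  obtain ⟨p, hQ⟩ := hQ
  refine ⟨p + (16 * Polynomial.X + 20 + (36 * Polynomial.X + 10) + 1) + 1, ?_⟩
  rintro n A hI ⟨π₀, hπ₀⟩
  have hT : (p + (16 * Polynomial.X + 20 + (36 * Polynomial.X + 10) + 1) + 1 :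
      Polynomial ℕ).eval n = p.eval n + (16 * n + 20 + (36 * n + 10) + 1) + 1 := by simp
  rw [hT]
  -- One admissible permutation provides a building sequence, so the guarantee for `Q` applies to
  -- this input.
  obtain ⟨a₀, ha₀, -⟩ := exists_builtFrom ((pathOf_mem_MZ π₀).2 hπ₀)
  obtain ⟨hH, c, hc, hc₀⟩ := hQ n A hI ⟨a₀, ha₀⟩
  have hH : Halts ([Q], Store.input [n, A]) (p.eval n) := hH
  have hS : ∀ z ∈ (runFor (p.eval n) ([Q], Store.input [n, A])).support, z.2.output ∈ S n A := by
    intro z hz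
    by_contra hz'
    exact mem_support_output hz (hc₀ _ hz')
  have hS' := fun z hz => samples_pathProg_labelProg (hS z hz) rfl
  have hH' := fun z hz => (hS' z hz).1
  -- The common probability is the constant of proportionality of `Q` itself: the weight `P a` of
  -- the only sequence that leads to `π` cancels against `1 / P a`.
  refine ⟨hH.seq hH', (isUniformOn_of_const (c := c) ?_ fun l hl => ?_).1⟩
  · rintro _ ⟨π, hπ, rfl⟩
    have hmz := (pathOf_mem_MZ π).2 hπ
    obtain ⟨a, ha, hb⟩ := exists_builtFrom hmz
    refine (hH.seq_output_apply hH' (o := a) (w := (P a : ℝ≥0∞)⁻¹) ?_).trans ?_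
    · intro z hz
      split_ifs with heq
      · rw [(hS' z hz).2.1 _ ⟨π, ⟨hmz, heq ▸ hb⟩, rfl⟩, heq]
      · refine (hS' z hz).2.2 _ ?_
        rintro ⟨σ, ⟨-, hσ⟩, hσπ⟩
        rw [permCode_injective hσπ] at hσ
        exact heq (eq_of_builtFrom (hS z hz) ha hσ hb)
    · have h := hc a ha
      rw [outputLaw] at h
      rw [h, mul_assoc, ENNReal.mul_inv_cancel _ (ENNReal.natCast_ne_top _), mul_one]
      exact_mod_cast (P_pos ha hmz hb).ne'
  · refine (hH.seq_output_apply hH' (o := []) (w := 0) fun z hz => ?_).trans (mul_zero _)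
    rw [ite_self]
    refine (hS' z hz).2.2 _ ?_
    rintro ⟨π, ⟨hmz, -⟩, rfl⟩
    exact hl ⟨π, (pathOf_mem_MZ π).1 hmz, rfl⟩

end DispSampling

theorem theorem10 :
    ∃ R₁ R₂ : DispSampling.Prog,
      DispSampling.SamplesPathOfSequence R₁ ∧
      DispSampling.SamplesPermutationOfPath R₂ ∧
      ∀ (I : Set (ℕ × ℕ)) (Q : DispSampling.Prog),
        DispSampling.SamplesSequences I Q →
          DispSampling.SamplesPermutations I (Q.seq (R₁.seq R₂)) :=
  ⟨DispSampling.pathProg, DispSampling.labelProg, DispSampling.samplesPathOfSequence_pathProg,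
    DispSampling.samplesPermutationOfPath_labelProg, fun _ _ hQ => hQ.samplesPermutations⟩
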